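/- **Conventions.** Let $0<a\le\infty$ and let $I_a=[-a,a]$ if $a<\infty$ and $I_a=\mathbb R$ if $a=\infty$. A function $f:I_a\to\mathbb C$ is *complex analytic in $I_a$* if it is the restriction of a function $f(z)$ of a complex variable that is analytic at every point of $I_a$. Write $\rho_0\in(0,\infty]$ for the distance from the origin to the nearest singularity of the analytic function $f(z)$, i.e. the radius of the largest open disc about $0$ to which it continues analytically ($\rho_0=\infty$ if $f$ is entire). For finite $a$, $\operatorname{PV}\!\int_{-a}^a$ denotes the Cauchy principal value at $x=\omega\in(-a,a)$. The finite part $\operatorname{FP}\!\!\int_0^a h(x)\,dx$ is $\lim_{\varepsilon\to0^+}C_\varepsilon$, where $\int_\varepsilon^a h(x)\,dx=C_\varepsilon+D_\varepsilon$, $C_\varepsilon$ converges, and $D_\varepsilon$ is a linear combination of finitely many powers $\varepsilon^{-p}$ with $p>0$ and of $\ln\varepsilon$. For $a=\infty$, each of $\operatorname{PV}\!\int_{-\infty}^{\infty}$, $\operatorname{FP}\!\!\int_0^\infty$ and $\int_0^\infty$ means the limit as $b\to\infty$ of the corresponding expression with $b$ in place of $a$. **Theorem.** Let $f$ be complex analytic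 in $I_a$. If $a=\infty$, assume moreover that $$\operatorname{PV}\!\!\int_{-\infty}^\infty\frac{\operatorname{sgn}(x)f(x)}{\omega-x}\,dx=\lim_{b\to\infty}\operatorname{PV}\!\!\int_{-b}^{b}\frac{\operatorname{sgn}(x)f(x)}{\omega-x}\,dx$$ exists for every real $\omega$ with $0<|\omega|<\rho_0$. Then in each of the following cases all the principal values, finite parts and integrals that appear exist, the infinite series converge absolutely, and the stated equality holds. 1. If $f(0)\ne0$, then for all real $\omega$ with $0<|\omega|<\min(a,\rho_0)$, $$\operatorname{PV}\!\!\int_{-a}^a\frac{\operatorname{sgn}(x)f(x)}{\omega-x}\,dx=-\sum_{k=0}^\infty\omega^k\ \operatorname{FP}\!\!\int_0^a\frac{(-1)^kf(-x)+f(x)}{x^{k+1}}\,dx+2f(\omega)\ln|\omega| .$$ 2. If $f(0)\neq 0$ and $f$ is even, then for the same $\omega$, $$\operatorname{PV}\!\!\int_{-a}^a\frac{\operatorname{sgn}(x)f(x)}{\omega-x}\,dx=-2\sum_{k=0}^\infty\omega^{2k}\ \operatorname{FP}\!\!\int_0^a\frac{f(x)}{x^{2k+1}}\,dx+2f(\omega)\ln|\omega|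 .$$ 3. If $f$ has a zero of order $m\ge1$ at the origin, $f(x)=x^mg(x)$ on $I_a$ with $g$ complex analytic in $I_a$ and $g(0)\ne0$, then for all real $\omega$ with $|\omega|<\min(a,\rho_0)$ (where $\omega^m\ln|\omega|$ is read as $0$ at $\omega=0$, and $0^0=1$), $$\begin{aligned}\operatorname{PV}\!\!\int_{-a}^a\frac{\operatorname{sgn}(x)f(x)}{\omega-x}\,dx=&-\sum_{k=0}^{m-1}\omega^k\int_0^a x^{m-k-1}\big[(-1)^{k+m}g(-x)+g(x)\big]dx\\&-\sum_{k=0}^\infty\omega^{k+m}\ \operatorname{FP}\!\!\int_0^a\frac{(-1)^kg(-x)+g(x)}{x^{k+1}}\,dx+2\omega^mg(\omega)\ln|\omega| .\end{aligned}$$ 4. If in case 3 the function $g$ is even, then for the same $\omega$, $$\begin{aligned}\operatorname{PV}\!\!\int_{-a}^a\frac{\operatorname{sgn}(x)f(x)}{\omega-x}\,dx=&-2\sum_{k=0}^\infty\omega^{2k+m}\ \operatorname{FP}\!\!\int_0^a\frac{g(x)}{x^{2k+1}}\,dx+2\omega^mg(\omega)\ln|\omega|\\&-2\sum_{k=0}^{\lfloor(m-2)/2\rfloor}\omega^{2k+2\lfloor(m+1)/2\rfloor-m}\int_0^a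 x^{2\lfloor(m-2)/2\rfloor-2k+1}g(x)\,dx ,\end{aligned}$$ where the last sum is empty for $m=1$. In particular, if $a=\infty$ and $f$ is entire, the formulas hold for all real $\omega$ (with $\omega\ne0$ in cases 1 and 2). -/

import Mathlib

open Filter Topology MeasureTheory
open scoped ENNReal

noncomputable section

namespace HilbertFP

/-- The symmetric real interval of half-length `a`: `[-a, a]` for finite `a`, all of `ℝ` for
`a = ∞`. -/
def symInterval (a : ℝ≥0∞) : Set ℝ := {x : ℝ | ‖x‖ₑ ≤ a}

/-- `f` is complex analytic in `I`: it is the restriction to `I` of a function of a complex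
variable that is analytic at (hence in a neighbourhood of) every point of `I`. -/
def ComplexAnalyticOn (f : ℝ → ℂ) (I : Set ℝ) : Prop :=
  ∃ F : ℂ → ℂ, (∀ x ∈ I, AnalyticAt ℂ F (x : ℂ)) ∧ ∀ x ∈ I, F (x : ℂ) = f x

/-- The distance from the origin to the nearest singularity of the analytic extension of `f`:
the radius of the largest open disc about `0` in which that extension is analytic (`∞` when the
extension is entire). The extension is determined by `f` near `0`, by analytic continuation. -/
def singularityDist (f : ℝ → ℂ) : ℝ≥0∞ :=
  sSup {r : ℝ≥0∞ | ∃ F : ℂ → ℂ, (∀ z : ℂ, ‖z‖ₑ < r → AnalyticAt ℂ F z) ∧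
    ∀ᶠ x : ℝ in 𝓝 0, F (x : ℂ) = f x}

/-- `P b L` says that some integral with (finite) limit of integration `b` has the value `L`.
`UpTo P a L` says that the same integral with limit of integration `a ≤ ∞` has the value `L`,
where the integral for `a = ∞` is the limit, as `b → ∞`, of the integrals for finite `b`. -/
def UpTo (P : ℝ → ℂ → Prop) (a : ℝ≥0∞) (L : ℂ) : Prop :=
  (a ≠ ∞ ∧ P a.toReal L) ∨
  (a = ∞ ∧ ∃ v : ℝ → ℂ, (∀ᶠ b : ℝ in atTop, P b (v b)) ∧ Tendsto v atTop (𝓝 L))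

/-- The convergent integral `∫₀ᵇ h` exists and equals `L`. -/
def HasIntegralTo (h : ℝ → ℂ) (b : ℝ) (L : ℂ) : Prop :=
  IntervalIntegrable h volume 0 b ∧ ∫ x in (0 : ℝ)..b, h x = L

/-- The finite part of `∫₀ᵇ h` exists and equals `L`: for small `ε > 0` the integral `∫_ε^b h` is
`C_ε + D_ε`, where `D_ε` is a linear combination of finitely many diverging powers `ε ^ (-p)`,
`p > 0`, and of `ln ε`, and where `C_ε → L` as `ε → 0⁺`. -/
def HasFinitePartTo (h : ℝ → ℂ) (b : ℝ) (L : ℂ) : Prop :=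
  (∀ᶠ ε : ℝ in 𝓝[>] 0, IntervalIntegrable h volume ε b) ∧
  ∃ (s : Finset ℝ) (c : ℝ → ℂ) (d : ℂ), (∀ p ∈ s, 0 < p) ∧
    Tendsto (fun ε : ℝ => (∫ x in ε..b, h x) -
        (∑ p ∈ s, c p * ((ε ^ (-p) : ℝ) : ℂ) + d * (Real.log ε : ℂ)))
      (𝓝[>] 0) (𝓝 L)

/-- The Cauchy principal value of `∫_{-b}^b h`, with the singular point `ω ∈ (-b, b)`, exists and
equals `L`. -/
def HasPVTo (h : ℝ → ℂ) (ω b : ℝ) (L : ℂ) : Prop :=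
  (∀ᶠ ε : ℝ in 𝓝[>] 0, IntervalIntegrable h volume (-b) (ω - ε) ∧
    IntervalIntegrable h volume (ω + ε) b) ∧
  Tendsto (fun ε : ℝ => (∫ x in (-b)..(ω - ε), h x) + ∫ x in (ω + ε)..b, h x)
    (𝓝[>] 0) (𝓝 L)

/-- `∫₀ᵃ h = L` for `0 < a ≤ ∞`, a convergent integral (improper if `a = ∞`). -/
def HasIntegral (h : ℝ → ℂ) (a : ℝ≥0∞) (L : ℂ) : Prop := UpTo (HasIntegralTo h) a L

/-- The finite part of `∫₀ᵃ h` is `L`, for `0 < a ≤ ∞`. -/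
def HasFinitePart (h : ℝ → ℂ) (a : ℝ≥0∞) (L : ℂ) : Prop := UpTo (HasFinitePartTo h) a L

/-- The principal value of `∫_{-a}^a sgn(x) f(x) / (ω - x) dx` exists and equals `L`, for
`|ω| < a ≤ ∞`; for `a = ∞` it is the limit of the principal values over `[-b, b]`. -/
def HasSgnHilbert (f : ℝ → ℂ) (a : ℝ≥0∞) (ω : ℝ) (L : ℂ) : Prop :=
  UpTo (HasPVTo (fun x : ℝ => ((Real.sign x : ℝ) : ℂ) * f x / ((ω : ℂ) - (x : ℂ))) ω) a L

end HilbertFP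

end

namespace HilbertFP

/-! For finite `b`, fix `ω` and divide: `f x = f ω + (x - ω) q x`, with `q` analytic wherever `f`
is. In the principal value the constant `f ω` contributes `f ω (2 log |ω| - log (b - ω) - log (b +
ω))`, and the rest is the ordinary integral `-∫₀ᵇ (q x - q (-x))`. On the series side, let `T k` be
the finite part attached to `f`, and `U k` the finite part of `(q x + (-1)^(k+1) q (-x)) / x^k`. The
same division gives `T k = f ω (1 + (-1)^k) FP∫ x^(-k-1) + U k - ω U (k+1)`. Multiplied by `ω^k` and
summed, the `U` terms telescope to `U 0 = ∫₀ᵇ (q x - q (-x))`, while the powers sum to `f ω (log (b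
- ω) + log (b + ω))`. Comparing the two sides proves the formula (`hasSum_and_hasPVTo`). Convergence
rests on the estimate `‖U k‖ ≤ C h^(-k)` for a radius `h > |ω|` inside the disc of analyticity.

For `a = ∞` the limit `b → ∞` must pass through the series. Existence of the principal values at
`±h/2` makes two combinations of `f x` and `f (-x)` conditionally integrable at infinity.
Integration by parts then bounds their integrals against `x^(-n)` by `C h^(-n)`, uniformly in `n`
and `b` (`exists_bound_integral_mul_inv_pow`), and dominated convergence for series applies.

This single formula, valid also at `ω = 0` when `f 0 = 0`, yields all four cases: when `f = x^m g`,
the first `m` finite parts are ordinary integrals, and parity kills every second coefficient. -/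

/-! ### Calculus of finite parts -/

theorem tendsto_ofReal_zero {α : Type*} {l : Filter α} {f : α → ℝ} (h : Tendsto f l (𝓝 0)) :
    Tendsto (fun x => (f x : ℂ)) l (𝓝 0) := by
  have := (Complex.continuous_ofReal.tendsto 0).comp h
  rwa [Complex.ofReal_zero] at this

/-- Multiplying by `ε ^ a`, with `a` the largest exponent, sends every term but `c a` to zero, so `c
a = 0`. Induction removes all the powers, and division by `log ε` then removes the logarithm. This
is what makes a finite part well defined. -/
theorem eq_zero_of_tendsto_divergent (s : Finset ℝ) (c : ℝ → ℂ) (d L : ℂ) (hs : ∀ p ∈ s, 0 < p)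
    (h : Tendsto (fun ε : ℝ => ∑ p ∈ s, c p * ((ε ^ (-p) : ℝ) : ℂ) + d * (Real.log ε : ℂ))
      (𝓝[>] 0) (𝓝 L)) : L = 0 := by
  induction s using Finset.induction_on_max with
  | empty =>
    simp only [Finset.sum_empty, zero_add] at h
    have hlog : Tendsto (fun ε : ℝ => ((Real.log ε)⁻¹ : ℝ)) (𝓝[>] 0) (𝓝 0) :=
      Real.tendsto_log_nhdsGT_zero.inv_tendsto_atBot
    have hlog' : Tendsto (fun ε : ℝ => (((Real.log ε)⁻¹ : ℝ) : ℂ)) (𝓝[>] 0) (𝓝 0) :=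
      tendsto_ofReal_zero hlog
    have h1 := h.mul hlog'
    rw [mul_zero] at h1
    have h2 : Tendsto (fun _ : ℝ => d) (𝓝[>] 0) (𝓝 0) := by
      refine h1.congr' ?_
      filter_upwards [Ioo_mem_nhdsGT (zero_lt_one' ℝ)] with ε hε
      have : Real.log ε ≠ 0 := (Real.log_neg hε.1 hε.2).ne
      have : (Real.log ε : ℂ) ≠ 0 := by exact_mod_cast this
      push_cast
      field_simp
    have hd : d = 0 := tendsto_nhds_unique tendsto_const_nhds h2
    subst hd
    simp only [zero_mul] at h
    exact (tendsto_nhds_unique tendsto_const_nhds h).symm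
  | insert a s ha ih =>
    have has : a ∉ s := fun h => lt_irrefl _ (ha a h)
    have ha0 : 0 < a := hs a (Finset.mem_insert_self _ _)
    simp only [Finset.sum_insert has] at h
    have hpow : ∀ q : ℝ, 0 < q → Tendsto (fun ε : ℝ => ((ε ^ q : ℝ) : ℂ)) (𝓝[>] 0) (𝓝 0) := by
      intro q hq
      have : Tendsto (fun ε : ℝ => ε ^ q) (𝓝[>] 0) (𝓝 0) := by
        have := (Real.continuousAt_rpow_const 0 q (Or.inr hq.le)).tendsto
        rw [Real.zero_rpow hq.ne'] at this
        exact this.mono_left nhdsWithin_le_nhds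
      exact tendsto_ofReal_zero this
    have h1 := h.mul (hpow a ha0)
    rw [mul_zero] at h1
    have hlog : Tendsto (fun ε : ℝ => ((Real.log ε * ε ^ a : ℝ) : ℂ)) (𝓝[>] 0) (𝓝 0) :=
      tendsto_ofReal_zero (tendsto_log_mul_rpow_nhdsGT_zero ha0)
    have h2 : Tendsto (fun ε : ℝ => c a + ∑ p ∈ s, c p * ((ε ^ (a - p) : ℝ) : ℂ) +
        d * ((Real.log ε * ε ^ a : ℝ) : ℂ)) (𝓝[>] 0) (𝓝 (c a + ∑ p ∈ s, c p * 0 + d * 0)) :=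
      (tendsto_const_nhds.add (tendsto_finsetSum _ fun p hp =>
        (hpow _ (sub_pos.2 (ha p hp))).const_mul _)).add (hlog.const_mul _)
    simp only [mul_zero, Finset.sum_const_zero, add_zero] at h2
    have h3 : c a = 0 := by
      refine tendsto_nhds_unique h2 (h1.congr' ?_)
      filter_upwards [self_mem_nhdsWithin] with ε hε
      have hε : (0 : ℝ) < ε := hε
      have e1 : ∀ p : ℝ, ((ε ^ (a - p) : ℝ) : ℂ) = ((ε ^ (-p) : ℝ) : ℂ) * ((ε ^ a : ℝ) : ℂ) := by
        intro p
        rw [← Complex.ofReal_mul, ← Real.rpow_add hε]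
        congr 2; ring
      have e2 : ((ε ^ (-a) : ℝ) : ℂ) * ((ε ^ a : ℝ) : ℂ) = 1 := by
        rw [← e1]; simp
      simp only [e1, add_mul, Finset.sum_mul, mul_assoc, Complex.ofReal_mul, e2, mul_one]
    simp only [h3, zero_mul, zero_add] at h
    exact ih (fun p hp => hs p (Finset.mem_insert_of_mem hp)) h

variable {φ ψ : ℝ → ℂ} {b : ℝ} {L M : ℂ}

theorem HasFinitePartTo.congr (hb : 0 < b) (h : HasFinitePartTo φ b L)
    (e : ∀ x, 0 < x → x ≤ b → φ x = ψ x) : HasFinitePartTo ψ b L := by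
  obtain ⟨hi, s, c, d, hs, ht⟩ := h
  have hmem : ∀ ε : ℝ, ε ∈ Set.Ioo 0 b → ∀ x ∈ Set.uIoc ε b, φ x = ψ x := by
    intro ε hε x hx
    rw [Set.uIoc_of_le hε.2.le] at hx
    exact e x (hε.1.trans hx.1) hx.2
  refine ⟨?_, s, c, d, hs, ht.congr' ?_⟩
  · filter_upwards [hi, Ioo_mem_nhdsGT hb] with ε h1 hε
    exact h1.congr (hmem ε hε)
  · filter_upwards [Ioo_mem_nhdsGT hb] with ε hε
    rw [intervalIntegral.integral_congr_ae (Eventually.of_forall (hmem ε hε))]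

theorem HasFinitePartTo.const_mul (h : HasFinitePartTo φ b L) (r : ℂ) :
    HasFinitePartTo (fun x => r * φ x) b (r * L) := by
  obtain ⟨hi, s, c, d, hs, ht⟩ := h
  refine ⟨hi.mono fun ε h => h.const_mul r, s, fun p => r * c p, r * d, hs,
    (ht.const_mul r).congr fun ε => ?_⟩
  rw [intervalIntegral.integral_const_mul]
  simp only [mul_sub, mul_add, Finset.mul_sum, mul_assoc]

theorem HasFinitePartTo.add (h : HasFinitePartTo φ b L) (h' : HasFinitePartTo ψ b M) :
    HasFinitePartTo (fun x => φ x + ψ x) b (L + M) := by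
  obtain ⟨hi, s, c, d, hs, ht⟩ := h
  obtain ⟨hi', s', c', d', hs', ht'⟩ := h'
  refine ⟨by filter_upwards [hi, hi'] with ε h1 h2 using h1.add h2, s ∪ s',
    fun p => (if p ∈ s then c p else 0) + (if p ∈ s' then c' p else 0), d + d', ?_,
    (ht.add ht').congr' ?_⟩
  · intro p hp
    rcases Finset.mem_union.1 hp with h | h
    exacts [hs p h, hs' p h]
  · filter_upwards [hi, hi'] with ε h1 h2
    rw [intervalIntegral.integral_add h1 h2]
    have e1 : ∀ (t t' : Finset ℝ) (k : ℝ → ℂ), t ⊆ t' →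
        ∑ p ∈ t', (if p ∈ t then k p else 0) * ((ε ^ (-p) : ℝ) : ℂ) =
          ∑ p ∈ t, k p * ((ε ^ (-p) : ℝ) : ℂ) := by
      intro t t' k htt
      simp only [ite_mul, zero_mul]
      rw [Finset.sum_ite_mem, Finset.inter_eq_right.2 htt]
    simp only [add_mul, Finset.sum_add_distrib]
    rw [e1 s _ c Finset.subset_union_left, e1 s' _ c' Finset.subset_union_right]
    ring

theorem HasFinitePartTo.of_intervalIntegrable (hb : 0 < b)
    (h : IntervalIntegrable φ volume 0 b) : HasFinitePartTo φ b (∫ x in (0 : ℝ)..b, φ x) := by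
  refine ⟨?_, ∅, 0, 0, by simp, ?_⟩
  · filter_upwards [Ioo_mem_nhdsGT hb] with ε hε
    refine h.mono_set ?_
    rw [Set.uIcc_of_le hε.2.le, Set.uIcc_of_le hb.le]
    exact Set.Icc_subset_Icc_left hε.1.le
  · have h1 := intervalIntegral.continuousOn_primitive_interval_left
      (f := φ) (μ := volume) (a := 0) (b := b)
      (by rw [Set.uIcc_of_le hb.le]; exact (intervalIntegrable_iff_integrableOn_Icc_of_le hb.le).1 h)
    rw [Set.uIcc_of_le hb.le] at h1
    have h2 := (h1 0 (Set.left_mem_Icc.2 hb.le)).tendsto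
    have h3 : 𝓝[>] (0 : ℝ) ≤ 𝓝[Set.Icc 0 b] 0 := by
      rw [← nhdsWithin_Ioc_eq_nhdsGT hb]
      exact nhdsWithin_mono _ Set.Ioc_subset_Icc_self
    simpa using h2.mono_left h3

theorem HasFinitePartTo.zero : HasFinitePartTo (fun _ => 0) b 0 :=
  ⟨by simp, ∅, 0, 0, by simp, by simp⟩

theorem HasFinitePartTo.sum {ι : Type*} (t : Finset ι) {φ : ι → ℝ → ℂ} {L : ι → ℂ}
    (h : ∀ i ∈ t, HasFinitePartTo (φ i) b (L i)) :
    HasFinitePartTo (fun x => ∑ i ∈ t, φ i x) b (∑ i ∈ t, L i) := by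
  classical
  induction t using Finset.induction_on with
  | empty => simpa using HasFinitePartTo.zero
  | insert i t hi ih =>
    simp only [Finset.sum_insert hi]
    exact (h i (Finset.mem_insert_self _ _)).add
      (ih fun j hj => h j (Finset.mem_insert_of_mem hj))

theorem HasFinitePartTo.extend {h : ℝ} (hφ : HasFinitePartTo φ h L)
    (hi : IntervalIntegrable φ volume h b) : HasFinitePartTo φ b (L + ∫ x in h..b, φ x) := by
  obtain ⟨h1, s, c, d, hs, ht⟩ := hφ
  refine ⟨h1.mono fun ε h => h.trans hi, s, c, d, hs, (ht.add_const _).congr' ?_⟩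
  filter_upwards [h1] with ε hε
  rw [← intervalIntegral.integral_add_adjacent_intervals hε hi]
  ring

/-- In the difference of the two representations the integral cancels, leaving a divergent
combination that converges to `L - M` up to sign. -/
theorem HasFinitePartTo.unique (h : HasFinitePartTo φ b L) (h' : HasFinitePartTo φ b M) :
    L = M := by
  obtain ⟨-, s, c, d, hs, ht⟩ := h.add (h'.const_mul (-1))
  simp only [neg_one_mul, add_neg_cancel, intervalIntegral.integral_zero, zero_sub] at ht
  have := eq_zero_of_tendsto_divergent s c d _ hs (by simpa using ht.neg)
  linear_combination -this

/-! ### Finite parts of powers, and of power series divided by powers -/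

/-- The finite part of `∫₀ᵇ x⁻¹⁻ⁿ dx`. -/
noncomputable def powFP (b : ℝ) (n : ℕ) : ℝ :=
  if n = 0 then Real.log b else -((n : ℝ) * b ^ n)⁻¹

/-- The finite part is the value at `b` of the antiderivative whose value at `ε` lies wholly in the
divergent scale, so `powFP` serves as both. -/
theorem hasDerivAt_powFP (n : ℕ) {x : ℝ} (hx : x ≠ 0) :
    HasDerivAt (fun x => powFP x n) ((x ^ (n + 1))⁻¹) x := by
  rcases Nat.eq_zero_or_pos n with rfl | hn
  · simpa [powFP] using Real.hasDerivAt_log hx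
  · simp only [powFP, hn.ne', if_false]
    have hn' : (n : ℝ) ≠ 0 := by exact_mod_cast hn.ne'
    have := (((hasDerivAt_pow n x).const_mul (n : ℝ)).inv
      (mul_ne_zero hn' (pow_ne_zero _ hx))).neg
    refine this.congr_deriv ?_
    obtain ⟨k, rfl⟩ : ∃ k, n = k + 1 := ⟨n - 1, by omega⟩
    rw [add_tsub_cancel_right]
    field_simp
    ring

theorem hasFinitePartTo_pow (hb : 0 < b) (n : ℕ) :
    HasFinitePartTo (fun x => ((x : ℂ) ^ (n + 1))⁻¹) b (powFP b n) := by
  have hint : ∀ ε ∈ Set.Ioo (0 : ℝ) b,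
      IntervalIntegrable (fun x : ℝ => ((x : ℂ) ^ (n + 1))⁻¹) volume ε b := by
    intro ε hε
    refine ContinuousOn.intervalIntegrable ?_
    rw [Set.uIcc_of_le hε.2.le]
    refine ContinuousOn.inv₀ (by fun_prop) fun x hx => ?_
    have : x ≠ 0 := (hε.1.trans_le hx.1).ne'
    exact pow_ne_zero _ (by exact_mod_cast this)
  have hval : ∀ ε ∈ Set.Ioo (0 : ℝ) b, (∫ x in ε..b, ((x : ℂ) ^ (n + 1))⁻¹) =
      ((powFP b n - powFP ε n : ℝ) : ℂ) := by
    intro ε hε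
    have e : ∀ x : ℝ, ((x : ℂ) ^ (n + 1))⁻¹ = (((x ^ (n + 1))⁻¹ : ℝ) : ℂ) := by
      intro x; push_cast; rfl
    rw [intervalIntegral.integral_congr fun x _ => e x, intervalIntegral.integral_ofReal]
    congr 1
    refine intervalIntegral.integral_eq_sub_of_hasDerivAt (f := fun x => powFP x n) ?_ ?_
    · intro x hx
      rw [Set.uIcc_of_le hε.2.le] at hx
      exact hasDerivAt_powFP n (hε.1.trans_le hx.1).ne'
    · refine ContinuousOn.intervalIntegrable ?_
      rw [Set.uIcc_of_le hε.2.le]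
      refine ContinuousOn.inv₀ (by fun_prop) fun x hx => ?_
      exact pow_ne_zero _ (hε.1.trans_le hx.1).ne'
  refine ⟨?_, ?_⟩
  · filter_upwards [Ioo_mem_nhdsGT hb] with ε hε using hint ε hε
  rcases Nat.eq_zero_or_pos n with rfl | hn
  · refine ⟨∅, 0, -1, by simp, tendsto_const_nhds.congr' ?_⟩
    filter_upwards [Ioo_mem_nhdsGT hb] with ε hε
    rw [hval ε hε]
    simp [powFP]
  · refine ⟨{(n : ℝ)}, fun _ => (n : ℂ)⁻¹, 0, by simpa using hn, tendsto_const_nhds.congr' ?_⟩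
    filter_upwards [Ioo_mem_nhdsGT hb] with ε hε
    rw [hval ε hε]
    simp [powFP, hn.ne', Real.rpow_neg hε.1.le]
    ring

theorem abs_powFP_le (hb : 0 < b) (n : ℕ) :
    |powFP b n| ≤ (1 + |Real.log b|) * (b ^ n)⁻¹ := by
  rcases Nat.eq_zero_or_pos n with rfl | hn
  · simp [powFP]
  · simp only [powFP, hn.ne', if_false, abs_neg, mul_inv]
    rw [abs_of_pos (by positivity)]
    gcongr
    have : ((n : ℝ))⁻¹ ≤ 1 := inv_le_one_of_one_le₀ (by exact_mod_cast hn)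
    linarith [abs_nonneg (Real.log b)]

theorem norm_sub_partialSum_le {d : ℕ → ℂ} {h x : ℝ} {s : ℂ} (hh : 0 < h)
    (hd : Summable fun j => ‖d j‖ * h ^ j) (hx : 0 ≤ x) (hxh : x ≤ h)
    (hs : HasSum (fun j => d j * (x : ℂ) ^ j) s) (k : ℕ) :
    ‖s - ∑ j ∈ Finset.range k, d j * (x : ℂ) ^ j‖ ≤
      (∑' j, ‖d j‖ * h ^ j) * (h ^ k)⁻¹ * x ^ k := by
  have h1 : HasSum (fun j => d (j + k) * (x : ℂ) ^ (j + k))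
      (s - ∑ j ∈ Finset.range k, d j * (x : ℂ) ^ j) :=
    (hasSum_nat_add_iff' (f := fun j => d j * (x : ℂ) ^ j) k).2 hs
  have h2 : Summable fun j => ‖d (j + k)‖ * h ^ (j + k) :=
    (summable_nat_add_iff (f := fun j => ‖d j‖ * h ^ j) k).2 hd
  have h3 : (∑' j, ‖d (j + k)‖ * h ^ (j + k)) ≤ ∑' j, ‖d j‖ * h ^ j := by
    have := hd.sum_add_tsum_nat_add k
    have h0 : 0 ≤ ∑ j ∈ Finset.range k, ‖d j‖ * h ^ j :=
      Finset.sum_nonneg fun _ _ => by positivity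
    linarith
  have h4 : ∀ j, ‖d (j + k) * (x : ℂ) ^ (j + k)‖ ≤
      ‖d (j + k)‖ * h ^ (j + k) * ((h ^ k)⁻¹ * x ^ k) := by
    intro j
    rw [norm_mul, norm_pow, Complex.norm_real, Real.norm_of_nonneg hx, pow_add x, pow_add h]
    have : x ^ j ≤ h ^ j := pow_le_pow_left₀ hx hxh j
    calc ‖d (j + k)‖ * (x ^ j * x ^ k) ≤ ‖d (j + k)‖ * (h ^ j * x ^ k) := by gcongr
      _ = _ := by field_simp
  refine (h1.norm_le_of_bounded (h2.mul_right _).hasSum h4).trans ?_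
  rw [tsum_mul_right, mul_assoc]
  gcongr

/-- Split off the Taylor polynomial of degree below `k`: its terms become negative powers with known
finite parts, and the remainder over `x ^ k` is bounded, hence integrable. The point is that `C`
does not depend on `k`. -/
theorem exists_hasFinitePartTo_div_pow {u : ℝ → ℂ} {d : ℕ → ℂ} {h : ℝ} (hh : 0 < h)
    (hu : ContinuousOn u (Set.Ioc 0 h)) (hd : Summable fun j => ‖d j‖ * h ^ j)
    (hs : ∀ x : ℝ, 0 < x → x ≤ h → HasSum (fun j => d j * (x : ℂ) ^ j) (u x)) :
    ∃ C, ∀ k : ℕ, ∃ A, HasFinitePartTo (fun x => u x / (x : ℂ) ^ k) h A ∧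
      ‖A‖ ≤ C * (h ^ k)⁻¹ := by
  set D := ∑' j, ‖d j‖ * h ^ j with hD
  -- The first summand bounds the Taylor terms through `abs_powFP_le`; the second is the bound for
  -- the remainder times the length of the interval.
  refine ⟨D * ((1 + |Real.log h|) * h) + D * h, fun k => ?_⟩
  set rem : ℝ → ℂ := fun x => (u x - ∑ j ∈ Finset.range k, d j * (x : ℂ) ^ j) / (x : ℂ) ^ k
    with hrem
  have hbound : ∀ x ∈ Set.Ioc 0 h, ‖rem x‖ ≤ D * (h ^ k)⁻¹ := by
    intro x hx
    simp only [hrem, norm_div, norm_pow, Complex.norm_real, Real.norm_of_nonneg hx.1.le]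
    rw [div_le_iff₀ (pow_pos hx.1 _)]
    exact norm_sub_partialSum_le hh hd hx.1.le hx.2 (hs x hx.1 hx.2) k
  have hcont : ContinuousOn rem (Set.Ioc 0 h) := by
    refine ContinuousOn.div (hu.sub (by fun_prop)) (by fun_prop) fun x hx => ?_
    have : x ≠ 0 := hx.1.ne'
    exact pow_ne_zero _ (by exact_mod_cast this)
  have hint : IntervalIntegrable rem volume 0 h := by
    rw [intervalIntegrable_iff_integrableOn_Ioc_of_le hh.le]
    refine IntegrableOn.of_bound (C := D * (h ^ k)⁻¹) (by simp)
      (hcont.aestronglyMeasurable measurableSet_Ioc) ?_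
    exact (ae_restrict_iff' measurableSet_Ioc).2 (Eventually.of_forall hbound)
  have h1 := (HasFinitePartTo.sum (Finset.range k) fun j _ =>
    (hasFinitePartTo_pow hh (k - 1 - j)).const_mul (d j)).add
      (HasFinitePartTo.of_intervalIntegrable hh hint)
  refine ⟨_, h1.congr hh fun x hx hxh => ?_, ?_⟩
  · have hx0 : (x : ℂ) ≠ 0 := by exact_mod_cast hx.ne'
    have e : ∀ j ∈ Finset.range k, d j * ((x : ℂ) ^ (k - 1 - j + 1))⁻¹ =
        d j * (x : ℂ) ^ j / (x : ℂ) ^ k := by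
      intro j hj
      have hj := Finset.mem_range.1 hj
      have : (x : ℂ) ^ k = (x : ℂ) ^ (k - 1 - j + 1) * (x : ℂ) ^ j := by
        rw [← pow_add]; congr 1; omega
      rw [this]
      field_simp
    rw [Finset.sum_congr rfl e, ← Finset.sum_div, hrem]
    ring
  · refine (norm_add_le _ _).trans ?_
    rw [add_mul]
    refine add_le_add ?_ ?_
    · have e : ∀ j ∈ Finset.range k, ‖d j * (powFP h (k - 1 - j) : ℂ)‖ ≤
          ‖d j‖ * h ^ j * (((1 + |Real.log h|) * h) * (h ^ k)⁻¹) := by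
        intro j hj
        have hj := Finset.mem_range.1 hj
        rw [norm_mul, Complex.norm_real, Real.norm_eq_abs]
        have : (h ^ (k - 1 - j))⁻¹ = h ^ j * h * (h ^ k)⁻¹ := by
          have : h ^ k = h ^ (k - 1 - j) * h ^ j * h := by
            rw [← pow_add, ← pow_succ]; congr 1; omega
          rw [this]
          field_simp
        calc _ ≤ ‖d j‖ * ((1 + |Real.log h|) * (h ^ (k - 1 - j))⁻¹) := by
              gcongr; exact abs_powFP_le hh _
          _ = _ := by rw [this]; ring
      refine (norm_sum_le_of_le _ e).trans ?_
      rw [← Finset.sum_mul, mul_assoc D]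
      gcongr
      exact hd.sum_le_tsum _ fun _ _ => by positivity
    · have := intervalIntegral.norm_integral_le_of_norm_le_const (a := 0) (b := h) (f := rem)
        (C := D * (h ^ k)⁻¹) (by rwa [Set.uIoc_of_le hh.le])
      rw [sub_zero, abs_of_pos hh] at this
      linarith

/-! ### Finite parts of reflected quotients -/

/-- On `[-h, h]` the function `q` is the restriction of a function that is analytic in a disc
about the origin of radius larger than `h`. -/
def ExtendsToDisc (q : ℝ → ℂ) (h : ℝ) : Prop :=
  ∃ R > h, ∃ F : ℂ → ℂ, DifferentiableOn ℂ F (Metric.ball 0 R) ∧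
    ∀ x : ℝ, |x| ≤ h → F x = q x

/-- A radius strictly larger than `h` is what gives absolute convergence at the endpoint `h` itself.
-/
theorem ExtendsToDisc.exists_hasSum {q : ℝ → ℂ} {h : ℝ} (hh : 0 < h) (hq : ExtendsToDisc q h) :
    ∃ c : ℕ → ℂ, (Summable fun j => ‖c j‖ * h ^ j) ∧
      ∀ x : ℝ, |x| ≤ h → HasSum (fun j => c j * (x : ℂ) ^ j) (q x) := by
  obtain ⟨R, hR, F, hF, hFq⟩ := hq
  obtain ⟨r, hr, hrR⟩ := exists_between hR
  lift r to NNReal using (hh.trans hr).le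
  lift h to NNReal using hh.le
  have hp := (hF.mono (Metric.closedBall_subset_ball hrR)).hasFPowerSeriesOnBall
    (pos_of_gt (NNReal.coe_lt_coe.1 hr))
  set p := cauchyPowerSeries F 0 r
  have hrad : (h : ℝ≥0∞) < p.radius :=
    lt_of_lt_of_le (ENNReal.coe_lt_coe.2 (NNReal.coe_lt_coe.1 hr)) hp.r_le
  refine ⟨p.coeff, ?_, fun x hx => ?_⟩
  · simpa only [FormalMultilinearSeries.norm_apply_eq_norm_coef] using p.summable_norm_mul_pow hrad
  · have hmem : (x : ℂ) ∈ Metric.eball (0 : ℂ) r := by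
      rw [Metric.eball_coe]
      simpa using hx.trans_lt hr
    have := hp.hasSum hmem
    simp only [zero_add, FormalMultilinearSeries.apply_eq_pow_smul_coeff, smul_eq_mul,
      hFq x hx] at this
    simpa only [mul_comm] using this

/-- The integrand `((-1) ^ (k + 1) q(-x) + q(x)) / x ^ k`. -/
noncomputable def reflQuot (q : ℝ → ℂ) (k : ℕ) (x : ℝ) : ℂ :=
  ((-1) ^ (k + 1) * q (-x) + q x) / (x : ℂ) ^ k

theorem continuousOn_reflQuot {q : ℝ → ℂ} {h b : ℝ} (hh : 0 < h)
    (hq : ContinuousOn q (Set.Icc (-b) b)) (k : ℕ) :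
    ContinuousOn (reflQuot q k) (Set.Icc h b) := by
  rcases lt_or_ge b h with hb | hb
  · simp [Set.Icc_eq_empty_of_lt hb]
  have hlb : -b ≤ h := by linarith
  have h1 : ContinuousOn q (Set.Icc h b) :=
    hq.mono (Set.Icc_subset_Icc_left hlb)
  have h2 : ContinuousOn (fun x => q (-x)) (Set.Icc h b) :=
    hq.comp (by fun_prop) fun x hx => ⟨by linarith [hx.2], by linarith [hx.1, hx.2]⟩
  refine ContinuousOn.div ((continuousOn_const.mul h2).add h1) (by fun_prop) fun x hx => ?_
  have : x ≠ 0 := (hh.trans_le hx.1).ne'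
  exact pow_ne_zero _ (by exact_mod_cast this)

theorem exists_hasFinitePartTo_reflQuot_small {q : ℝ → ℂ} {h : ℝ} (hh : 0 < h)
    (hc : ContinuousOn q (Set.Icc (-h) h)) (hq : ExtendsToDisc q h) :
    ∃ (U : ℕ → ℂ) (C : ℝ), ∀ k, HasFinitePartTo (reflQuot q k) h (U k) ∧
      ‖U k‖ ≤ C * (h ^ k)⁻¹ := by
  obtain ⟨c, hc1, hc2⟩ := hq.exists_hasSum hh
  obtain ⟨C, hC⟩ := exists_hasFinitePartTo_div_pow hh
    (hc.mono fun x hx => ⟨by linarith [hx.1], hx.2⟩) hc1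
    fun x hx hxh => hc2 x (by rwa [abs_of_pos hx])
  obtain ⟨C', hC'⟩ := exists_hasFinitePartTo_div_pow (u := fun x => q (-x))
    (d := fun j => (-1) ^ j * c j) hh
    (hc.comp (by fun_prop) fun x hx => ⟨by linarith [hx.2], by linarith [hx.1]⟩)
    (by simpa using hc1)
    fun x hx hxh => by
      have := hc2 (-x) (by rwa [abs_neg, abs_of_pos hx])
      convert this using 2 with j
      push_cast
      rw [neg_pow]; ring
  choose A hA hA' using hC
  choose B hB hB' using hC'
  refine ⟨fun k => A k + (-1) ^ (k + 1) * B k, C + C', fun k => ⟨?_, ?_⟩⟩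
  · refine ((hA k).add ((hB k).const_mul _)).congr hh fun x hx _ => ?_
    simp only [reflQuot]
    ring
  · refine (norm_add_le _ _).trans ?_
    rw [add_mul, norm_mul, norm_pow, norm_neg, norm_one, one_pow, one_mul]
    exact add_le_add (hA' k) (hB' k)

/-- Analyticity is used only on `[0, h]`. On `[h, b]` boundedness of `q` and `x ^ k ≥ h ^ k` give
the same geometric rate. -/
theorem exists_hasFinitePartTo_reflQuot {q : ℝ → ℂ} {h b : ℝ} (hh : 0 < h) (hhb : h ≤ b)
    (hc : ContinuousOn q (Set.Icc (-b) b)) (hq : ExtendsToDisc q h) :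
    ∃ (U : ℕ → ℂ) (C : ℝ), ∀ k, HasFinitePartTo (reflQuot q k) b (U k) ∧
      ‖U k‖ ≤ C * (h ^ k)⁻¹ := by
  obtain ⟨U, C, hU⟩ := exists_hasFinitePartTo_reflQuot_small hh
    (hc.mono (Set.Icc_subset_Icc (by linarith) hhb)) hq
  obtain ⟨M, hM⟩ := isCompact_Icc.exists_bound_of_continuousOn hc
  refine ⟨fun k => U k + ∫ x in h..b, reflQuot q k x, C + (M + M) * (b - h), fun k => ⟨?_, ?_⟩⟩
  · refine (hU k).1.extend (ContinuousOn.intervalIntegrable ?_)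
    rw [Set.uIcc_of_le hhb]
    exact continuousOn_reflQuot hh hc k
  · refine (norm_add_le _ _).trans ?_
    rw [add_mul]
    refine add_le_add (hU k).2 ?_
    have := intervalIntegral.norm_integral_le_of_norm_le_const (a := h) (b := b)
      (f := reflQuot q k) (C := (M + M) * (h ^ k)⁻¹) fun x hx => ?_
    · rw [abs_of_nonneg (by linarith)] at this
      linarith
    rw [Set.uIoc_of_le hhb] at hx
    have hx0 : 0 < x := hh.trans hx.1
    have h1 := hM x ⟨by linarith, hx.2⟩
    have h2 := hM (-x) ⟨by linarith [hx.2], by linarith [hx.2]⟩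
    have hM0 : 0 ≤ M := (norm_nonneg _).trans h1
    rw [reflQuot, norm_div, norm_pow, Complex.norm_real, Real.norm_of_nonneg hx0.le,
      div_eq_mul_inv]
    have h3 : h ^ k ≤ x ^ k := pow_le_pow_left₀ hh.le hx.1.le k
    have h4 : ‖(-1) ^ (k + 1) * q (-x) + q x‖ ≤ M + M := by
      refine (norm_add_le _ _).trans (add_le_add ?_ h1)
      rwa [norm_mul, norm_pow, norm_neg, norm_one, one_pow, one_mul]
    gcongr

/-! ### Calculus of principal values -/

section PrincipalValue

variable {φ ψ : ℝ → ℂ} {ω b : ℝ} {L M : ℂ}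

theorem HasPVTo.congr (hω : |ω| < b) (h : HasPVTo φ ω b L)
    (e : ∀ x, |x| ≤ b → x ≠ ω → φ x = ψ x) : HasPVTo ψ ω b L := by
  obtain ⟨hω1, hω2⟩ := abs_lt.1 hω
  have e1 : ∀ ε ∈ Set.Ioo (0 : ℝ) (b - |ω|), (∀ x ∈ Set.uIoc (-b) (ω - ε), φ x = ψ x) ∧
      ∀ x ∈ Set.uIoc (ω + ε) b, φ x = ψ x := by
    intro ε hε
    have hε1 : 0 < ε := hε.1
    have hε2 : ε < b - |ω| := hε.2
    have := le_abs_self ω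
    have := neg_abs_le ω
    rw [Set.uIoc_of_le (by linarith), Set.uIoc_of_le (by linarith)]
    refine ⟨fun x hx => e x (abs_le.2 ⟨hx.1.le, by linarith [hx.2]⟩) ?_,
      fun x hx => e x (abs_le.2 ⟨by linarith [hx.1], hx.2⟩) ?_⟩
    · exact (show x < ω by linarith [hx.2]).ne
    · exact (show ω < x by linarith [hx.1]).ne'
  have hev := Ioo_mem_nhdsGT (sub_pos.2 hω)
  refine ⟨?_, h.2.congr' ?_⟩
  · filter_upwards [hev, h.1] with ε hε h1
    exact ⟨h1.1.congr (e1 ε hε).1, h1.2.congr (e1 ε hε).2⟩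
  · filter_upwards [hev] with ε hε
    rw [intervalIntegral.integral_congr_ae (Eventually.of_forall (e1 ε hε).1),
      intervalIntegral.integral_congr_ae (Eventually.of_forall (e1 ε hε).2)]

theorem HasPVTo.const_mul (h : HasPVTo φ ω b L) (r : ℂ) :
    HasPVTo (fun x => r * φ x) ω b (r * L) := by
  refine ⟨h.1.mono fun ε h => ⟨h.1.const_mul r, h.2.const_mul r⟩,
    (h.2.const_mul r).congr fun ε => ?_⟩
  simp only [intervalIntegral.integral_const_mul, mul_add]

theorem HasPVTo.add (h : HasPVTo φ ω b L) (h' : HasPVTo ψ ω b M) :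
    HasPVTo (fun x => φ x + ψ x) ω b (L + M) := by
  refine ⟨by filter_upwards [h.1, h'.1] with ε h1 h2 using ⟨h1.1.add h2.1, h1.2.add h2.2⟩,
    (h.2.add h'.2).congr' ?_⟩
  filter_upwards [h.1, h'.1] with ε h1 h2
  rw [intervalIntegral.integral_add h1.1 h2.1, intervalIntegral.integral_add h1.2 h2.2]
  ring

theorem HasPVTo.unique (h : HasPVTo φ ω b L) (h' : HasPVTo φ ω b M) : L = M :=
  tendsto_nhds_unique h.2 h'.2

theorem HasPVTo.zero : HasPVTo (fun _ => 0) ω b 0 := ⟨by simp, by simp⟩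

theorem HasPVTo.extend {h : ℝ} (hφ : HasPVTo φ ω h L)
    (h1 : IntervalIntegrable φ volume (-b) (-h)) (h2 : IntervalIntegrable φ volume h b) :
    HasPVTo φ ω b (L + ((∫ x in (-b)..(-h), φ x) + ∫ x in h..b, φ x)) := by
  refine ⟨hφ.1.mono fun ε h => ⟨h1.trans h.1, h.2.trans h2⟩, (hφ.2.add_const _).congr' ?_⟩
  filter_upwards [hφ.1] with ε hε
  rw [← intervalIntegral.integral_add_adjacent_intervals h1 hε.1,
    ← intervalIntegral.integral_add_adjacent_intervals hε.2 h2]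
  ring

theorem HasPVTo.of_intervalIntegrable (hω : |ω| < b) (h : IntervalIntegrable φ volume (-b) b) :
    HasPVTo φ ω b (∫ x in (-b)..b, φ x) := by
  obtain ⟨hω1, hω2⟩ := abs_lt.1 hω
  have hsub : ∀ c ∈ Set.Icc (-b) b, IntervalIntegrable φ volume (-b) c ∧
      IntervalIntegrable φ volume c b := by
    intro c hc
    constructor <;> refine h.mono_set ?_
    · rw [Set.uIcc_of_le hc.1, Set.uIcc_of_le (hc.1.trans hc.2)]
      exact Set.Icc_subset_Icc_right hc.2
    · rw [Set.uIcc_of_le hc.2, Set.uIcc_of_le (hc.1.trans hc.2)]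
      exact Set.Icc_subset_Icc_left hc.1
  have hcont : ContinuousAt (fun y => ∫ x in (-b)..y, φ x) ω := by
    have := intervalIntegral.continuousOn_primitive_interval'
      (f := φ) (μ := volume) (b₁ := -b) (b₂ := b) (a := -b) h Set.left_mem_uIcc
    rw [Set.uIcc_of_le (by linarith)] at this
    exact this.continuousAt (Icc_mem_nhds hω1 hω2)
  have t1 : Tendsto (fun ε : ℝ => ω - ε) (𝓝[>] 0) (𝓝 ω) := by
    have : Tendsto (fun ε : ℝ => ω - ε) (𝓝 0) (𝓝 (ω - 0)) :=
      (continuous_const.sub continuous_id).tendsto 0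
    rw [sub_zero] at this
    exact this.mono_left nhdsWithin_le_nhds
  have t2 : Tendsto (fun ε : ℝ => ω + ε) (𝓝[>] 0) (𝓝 ω) := by
    have : Tendsto (fun ε : ℝ => ω + ε) (𝓝 0) (𝓝 (ω + 0)) :=
      (continuous_const.add continuous_id).tendsto 0
    rw [add_zero] at this
    exact this.mono_left nhdsWithin_le_nhds
  have e1 := t1.eventually (Icc_mem_nhds hω1 hω2)
  have e2 := t2.eventually (Icc_mem_nhds hω1 hω2)
  refine ⟨?_, ?_⟩
  · filter_upwards [e1, e2] with ε h1 h2 using ⟨(hsub _ h1).1, (hsub _ h2).2⟩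
  · have := (hcont.tendsto.comp t1).add ((hcont.tendsto.comp t2).const_sub (∫ x in (-b)..b, φ x))
    rw [add_sub_cancel] at this
    refine this.congr' ?_
    filter_upwards [e2] with ε h2
    rw [← intervalIntegral.integral_add_adjacent_intervals (hsub _ h2).1 (hsub _ h2).2]
    simp

end PrincipalValue

/-! ### The kernel `sgn(x) / (ω - x)` -/

theorem monotone_sign : Monotone Real.sign := by
  intro x y hxy
  rcases lt_trichotomy x 0 with hx | rfl | hx
  · rw [Real.sign_of_neg hx]
    rcases Real.sign_apply_eq y with h | h | h <;> rw [h] <;> norm_num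
  · rcases hxy.eq_or_lt with rfl | hy
    · rfl
    · rw [Real.sign_of_pos hy]; simp
  · rw [Real.sign_of_pos hx, Real.sign_of_pos (hx.trans_le hxy)]

theorem intervalIntegrable_ofReal {u : ℝ → ℝ} {a b : ℝ} (h : IntervalIntegrable u volume a b) :
    IntervalIntegrable (fun x => (u x : ℂ)) volume a b :=
  ⟨h.1.ofReal, h.2.ofReal⟩

theorem intervalIntegrable_sign_mul {ψ : ℝ → ℂ} {a b : ℝ} (h : ContinuousOn ψ (Set.uIcc a b)) :
    IntervalIntegrable (fun x => (Real.sign x : ℂ) * ψ x) volume a b :=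
  (intervalIntegrable_ofReal monotone_sign.intervalIntegrable).mul_continuousOn h

theorem integral_sign_mul {q : ℝ → ℂ} {b : ℝ} (hb : 0 < b)
    (hq : ContinuousOn q (Set.Icc (-b) b)) :
    ∫ x in (-b)..b, (Real.sign x : ℂ) * q x = ∫ x in (0 : ℝ)..b, (q x - q (-x)) := by
  have c1 : ContinuousOn q (Set.uIcc (-b) 0) := hq.mono <| by
    rw [Set.uIcc_of_le (by linarith)]; exact Set.Icc_subset_Icc_right hb.le
  have c2 : ContinuousOn q (Set.uIcc 0 b) := hq.mono <| by
    rw [Set.uIcc_of_le hb.le]; exact Set.Icc_subset_Icc_left (by linarith)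
  have c3 : ContinuousOn (fun x => q (-x)) (Set.uIcc 0 b) := by
    refine hq.comp (by fun_prop) fun x hx => ?_
    rw [Set.uIcc_of_le hb.le] at hx
    exact ⟨by linarith [hx.2], by linarith [hx.1]⟩
  rw [← intervalIntegral.integral_add_adjacent_intervals (intervalIntegrable_sign_mul c1)
    (intervalIntegrable_sign_mul c2),
    intervalIntegral.integral_sub c2.intervalIntegrable c3.intervalIntegrable,
    intervalIntegral.integral_comp_neg, neg_zero,
    intervalIntegral.integral_congr_uIoo (g := fun x => -q x) (a := -b),
    intervalIntegral.integral_congr_uIoo (g := q) (a := 0), intervalIntegral.integral_neg]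
  · ring
  · intro x hx
    rw [Set.uIoo_of_le hb.le] at hx
    simp [Real.sign_of_pos hx.1]
  · intro x hx
    rw [Set.uIoo_of_le (by linarith)] at hx
    simp [Real.sign_of_neg hx.2]

/-- An antiderivative of `sgn(x) / (ω - x)`. -/
noncomputable def signKernelPrim (ω x : ℝ) : ℝ := Real.sign x * (Real.log ω - Real.log (x - ω))

theorem sign_eventuallyEq {x : ℝ} (hx : x ≠ 0) : Real.sign =ᶠ[𝓝 x] fun _ => Real.sign x := by
  rcases hx.lt_or_gt with h | h
  · filter_upwards [Iio_mem_nhds h] with y hy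
    rw [Real.sign_of_neg h, Real.sign_of_neg hy]
  · filter_upwards [Ioi_mem_nhds h] with y hy
    rw [Real.sign_of_pos h, Real.sign_of_pos hy]

theorem hasDerivAt_signKernelPrim {ω x : ℝ} (hx : x ≠ 0) (hxω : x ≠ ω) :
    HasDerivAt (signKernelPrim ω) (Real.sign x / (ω - x)) x := by
  have h1 : HasDerivAt (fun y => Real.sign x * (Real.log ω - Real.log (y - ω)))
      (Real.sign x * -((1 : ℝ) / (x - ω))) x :=
    ((((hasDerivAt_id x).sub_const ω).log (sub_ne_zero.2 hxω)).const_sub _).const_mul _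
  refine (h1.congr_of_eventuallyEq ?_).congr_deriv ?_
  · filter_upwards [sign_eventuallyEq hx] with y hy
    rw [signKernelPrim, hy]
  · rw [← neg_sub x ω, div_neg, one_div, div_eq_mul_inv, mul_neg]

/-- The constant `Real.log ω` is chosen so that the factor of `Real.sign x` vanishes at `0`,
cancelling the jump; `Real.log` takes the absolute value of its argument. -/
theorem continuousAt_signKernelPrim {ω x : ℝ} (hω : ω ≠ 0) (hxω : x ≠ ω) :
    ContinuousAt (signKernelPrim ω) x := by
  by_cases hx : x = 0
  · subst hx
    have h1 : Tendsto (fun y : ℝ => Real.log ω - Real.log (y - ω)) (𝓝 0) (𝓝 0) := by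
      have : ContinuousAt (fun y : ℝ => Real.log ω - Real.log (y - ω)) 0 :=
        continuousAt_const.sub ((continuousAt_id.sub continuousAt_const).log (by simpa using hω))
      simpa [ContinuousAt] using this
    have h2 : signKernelPrim ω 0 = 0 := by simp [signKernelPrim]
    rw [ContinuousAt, h2]
    refine squeeze_zero_norm (fun y => ?_) (by simpa using h1.norm)
    rw [signKernelPrim, norm_mul]
    refine mul_le_of_le_one_left (norm_nonneg _) ?_
    rcases Real.sign_apply_eq y with h | h | h <;> rw [h] <;> norm_num
  · exact (hasDerivAt_signKernelPrim hx hxω).continuousAt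

theorem signKernel_integral {ω c d : ℝ} (hω : ω ≠ 0) (h : ω ∉ Set.uIcc c d) :
    IntervalIntegrable (fun x : ℝ => (Real.sign x : ℂ) / ((ω : ℂ) - (x : ℂ))) volume c d ∧
    ∫ x in c..d, (Real.sign x : ℂ) / ((ω : ℂ) - (x : ℂ)) =
      ((signKernelPrim ω d - signKernelPrim ω c : ℝ) : ℂ) := by
  have hne : ∀ x ∈ Set.uIcc c d, x ≠ ω := fun x hx e => h (e ▸ hx)
  have hR : IntervalIntegrable (fun x : ℝ => Real.sign x / (ω - x)) volume c d := by
    simp only [div_eq_mul_inv]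
    refine (monotone_sign.intervalIntegrable (μ := volume)).mul_continuousOn ?_
    exact ContinuousOn.inv₀ (by fun_prop) fun x hx => sub_ne_zero.2 (hne x hx).symm
  have e : ∀ x : ℝ, (Real.sign x : ℂ) / ((ω : ℂ) - (x : ℂ)) =
      ((Real.sign x / (ω - x) : ℝ) : ℂ) := fun x => by push_cast; rfl
  simp only [e]
  refine ⟨intervalIntegrable_ofReal hR, ?_⟩
  rw [intervalIntegral.integral_ofReal]
  congr 1
  refine integral_eq_of_hasDerivAt_off_countable _ _ (Set.countable_singleton 0)
    (fun x hx => (continuousAt_signKernelPrim hω (hne x hx)).continuousWithinAt)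
    (fun x hx => hasDerivAt_signKernelPrim (by simpa using hx.2) (hne x ?_)) hR
  exact Set.Ioo_subset_Icc_self hx.1

theorem hasPVTo_signKernel {ω b : ℝ} (hω : ω ≠ 0) (hωb : |ω| < b) :
    HasPVTo (fun x : ℝ => (Real.sign x : ℂ) / ((ω : ℂ) - (x : ℂ))) ω b
      ((2 * Real.log |ω| - (Real.log (b - ω) + Real.log (b + ω)) : ℝ) : ℂ) := by
  -- The first bound keeps the excised interval inside `(-b, b)`; the second keeps `0` out of it, so
  -- the sign agrees at `ω ± ε` and the `log ε` terms cancel exactly.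
  have hev : ∀ᶠ ε : ℝ in 𝓝[>] 0, ε ∈ Set.Ioo 0 (min (b - |ω|) |ω|) :=
    Ioo_mem_nhdsGT (lt_min (sub_pos.2 hωb) (abs_pos.2 hω))
  have h1 := le_abs_self ω
  have h2 := neg_abs_le ω
  have key : ∀ ε ∈ Set.Ioo 0 (min (b - |ω|) |ω|),
      ω ∉ Set.uIcc (-b) (ω - ε) ∧ ω ∉ Set.uIcc (ω + ε) b := by
    intro ε hε
    have h3 := hε.1
    have h4 := lt_min_iff.1 hε.2
    rw [Set.uIcc_of_le (by linarith), Set.uIcc_of_le (by linarith)]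
    exact ⟨fun h => by linarith [h.2], fun h => by linarith [h.1]⟩
  refine ⟨?_, tendsto_const_nhds.congr' ?_⟩
  · filter_upwards [hev] with ε hε
    exact ⟨(signKernel_integral hω (key ε hε).1).1, (signKernel_integral hω (key ε hε).2).1⟩
  · filter_upwards [hev] with ε hε
    rw [(signKernel_integral hω (key ε hε).1).2, (signKernel_integral hω (key ε hε).2).2,
      ← Complex.ofReal_add]
    congr 1
    have h3 := hε.1
    have h4 := lt_min_iff.1 hε.2
    have hb : 0 < b := by linarith [abs_nonneg ω]
    have e1 : Real.sign (ω - ε) = Real.sign (ω + ε) := by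
      rcases hω.lt_or_gt with h | h
      · rw [abs_of_neg h] at h4
        rw [Real.sign_of_neg (by linarith), Real.sign_of_neg (by linarith)]
      · rw [abs_of_pos h] at h4
        rw [Real.sign_of_pos (by linarith), Real.sign_of_pos (by linarith)]
    have e2 : Real.log (-b - ω) = Real.log (b + ω) := by
      rw [← Real.log_neg_eq_log]; congr 1; ring
    simp only [signKernelPrim, e1, Real.sign_of_pos hb, Real.sign_neg, e2, Real.log_abs]
    have e3 : ω - ε - ω = -ε := by ring
    have e4 : ω + ε - ω = ε := by ring
    rw [e3, e4, Real.log_neg_eq_log]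
    ring

/-- The integrand is `f ω` times the kernel minus `sgn(x) q x`. At `ω = 0` the kernel has no
principal value, but its coefficient `f ω` is then zero. -/
theorem hasPVTo_of_factor {f q : ℝ → ℂ} {ω b : ℝ} (hωb : |ω| < b)
    (hω : ω ≠ 0 ∨ f ω = 0) (hq : ContinuousOn q (Set.Icc (-b) b))
    (hf : ∀ x, |x| ≤ b → f x = f ω + ((x : ℂ) - ω) * q x) :
    HasPVTo (fun x : ℝ => ((Real.sign x : ℝ) : ℂ) * f x / ((ω : ℂ) - (x : ℂ))) ω b
      (f ω * (2 * Real.log |ω| - (Real.log (b - ω) + Real.log (b + ω)) : ℝ) -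
        ∫ x in (0 : ℝ)..b, (q x - q (-x))) := by
  have hb : 0 < b := (abs_nonneg ω).trans_lt hωb
  have h1 : HasPVTo (fun x : ℝ => f ω * ((Real.sign x : ℂ) / ((ω : ℂ) - (x : ℂ)))) ω b
      (f ω * (2 * Real.log |ω| - (Real.log (b - ω) + Real.log (b + ω)) : ℝ)) := by
    rcases hω with hω | hω
    · exact (hasPVTo_signKernel hω hωb).const_mul _
    · simpa [hω] using HasPVTo.zero
  have h2 := (HasPVTo.of_intervalIntegrable hωb
    (intervalIntegrable_sign_mul (a := -b) (b := b)
      (by rwa [Set.uIcc_of_le (by linarith)]))).const_mul (-1)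
  rw [integral_sign_mul hb hq, neg_one_mul] at h2
  rw [sub_eq_add_neg]
  refine (h1.add h2).congr hωb fun x hx hxω => ?_
  have : (ω : ℂ) - x ≠ 0 := sub_ne_zero.2 (by exact_mod_cast hxω.symm)
  rw [hf x hx]
  field_simp
  ring

/-! ### Division by `x - ω` and the telescoping series on a finite interval -/

theorem exists_factor {f : ℝ → ℂ} {ω h b : ℝ} (hωh : |ω| < h)
    (hc : ContinuousOn f (Set.Icc (-b) b)) (hf : ExtendsToDisc f h) :
    ∃ q : ℝ → ℂ, ContinuousOn q (Set.Icc (-b) b) ∧ ExtendsToDisc q h ∧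
      ∀ x, |x| ≤ b → f x = f ω + ((x : ℂ) - ω) * q x := by
  obtain ⟨R, hR, F, hF, hFf⟩ := hf
  have hωR : Metric.ball (0 : ℂ) R ∈ 𝓝 (ω : ℂ) := by
    refine Metric.isOpen_ball.mem_nhds ?_
    simpa using hωh.trans hR
  have hD : DifferentiableOn ℂ (dslope F ω) (Metric.ball 0 R) :=
    (Complex.differentiableOn_dslope hωR).2 hF
  -- The removable singularity `ω` lies inside the disc, where `dslope` fills it analytically;
  -- outside, the plain quotient is continuous.
  set q : ℝ → ℂ := fun x => if |x| ≤ h then dslope F ω x else (f x - f ω) / ((x : ℂ) - ω) with hq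
  have hq1 : ∀ x : ℝ, |x| ≤ h → q x = dslope F ω x := fun x hx => if_pos hx
  have hq2 : ∀ x : ℝ, x ≠ ω → q x = (f x - f ω) / ((x : ℂ) - ω) := by
    intro x hx
    by_cases hxh : |x| ≤ h
    · rw [hq1 x hxh, dslope_of_ne _ (by exact_mod_cast hx), slope_def_field, hFf x hxh,
        hFf ω hωh.le]
    · exact if_neg hxh
  refine ⟨q, ?_, ⟨R, hR, dslope F ω, hD, fun x hx => (hq1 x hx).symm⟩, ?_⟩
  · intro x hx
    by_cases hxω : x = ω
    · subst hxω
      have h1 : ContinuousAt (fun y : ℝ => dslope F (x : ℂ) y) x :=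
        ContinuousAt.comp (f := fun y : ℝ => (y : ℂ)) (hD.continuousOn.continuousAt hωR)
          Complex.continuous_ofReal.continuousAt
      refine (h1.congr ?_).continuousWithinAt
      filter_upwards [Ioo_mem_nhds (abs_lt.1 hωh).1 (abs_lt.1 hωh).2] with y hy
      exact (hq1 y (abs_lt.2 hy).le).symm
    · have hne : (x : ℂ) - ω ≠ 0 := sub_ne_zero.2 (by exact_mod_cast hxω)
      have h1 : ContinuousWithinAt (fun x : ℝ => (f x - f ω) / ((x : ℂ) - ω))
          (Set.Icc (-b) b) x :=
        ((hc x hx).sub continuousWithinAt_const).div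
          (by fun_prop) hne
      refine h1.congr_of_eventuallyEq ?_ (hq2 x hxω)
      filter_upwards [nhdsWithin_le_nhds (isOpen_ne.mem_nhds hxω)] with y hy using hq2 y hy
  · intro x hx
    by_cases hxω : x = ω
    · subst hxω; simp
    · have hne : (x : ℂ) - ω ≠ 0 := sub_ne_zero.2 (by exact_mod_cast hxω)
      rw [hq2 x hxω]
      field_simp
      ring

theorem hasSum_sub_succ {g : ℕ → ℂ} (hg : Summable g) :
    HasSum (fun k => g k - g (k + 1)) (g 0) := by
  have h := hg.hasSum.sub ((hasSum_nat_add_iff' 1).2 hg.hasSum)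
  simpa using h

theorem summable_pow_mul_of_bound {U : ℕ → ℂ} {C h ω : ℝ} (hωh : |ω| < h)
    (hU : ∀ k, ‖U k‖ ≤ C * (h ^ k)⁻¹) : Summable fun k => (ω : ℂ) ^ k * U k := by
  have hh : 0 < h := (abs_nonneg ω).trans_lt hωh
  have hs : Summable fun k : ℕ => C * (|ω| / h) ^ k :=
    (summable_geometric_of_lt_one (by positivity) ((div_lt_one hh).2 hωh)).mul_left C
  refine Summable.of_norm_bounded hs fun k => ?_
  rw [norm_mul, norm_pow, Complex.norm_real, Real.norm_eq_abs, div_pow]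
  calc |ω| ^ k * ‖U k‖ ≤ |ω| ^ k * (C * (h ^ k)⁻¹) := by gcongr; exact hU k
    _ = _ := by ring

/-- These are the Taylor series of `log (1 - ω/b)` and `log (1 + ω/b)` added together; the term `k =
0` supplies `2 log b`. -/
theorem hasSum_powFP {ω b : ℝ} (hωb : |ω| < b) :
    HasSum (fun k : ℕ => ω ^ k * (((-1) ^ k + 1) * powFP b k))
      (Real.log (b - ω) + Real.log (b + ω)) := by
  have hb : 0 < b := (abs_nonneg ω).trans_lt hωb
  obtain ⟨h1, h2⟩ := abs_lt.1 hωb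
  have hlt : |ω / b| < 1 := by rw [abs_div, abs_of_pos hb]; exact (div_lt_one hb).2 hωb
  have s1 := Real.hasSum_pow_div_log_of_abs_lt_one hlt
  have s2 := Real.hasSum_pow_div_log_of_abs_lt_one (x := -(ω / b)) (by rwa [abs_neg])
  have e1 : Real.log (1 - ω / b) = Real.log (b - ω) - Real.log b := by
    rw [← Real.log_div (by linarith) hb.ne']; congr 1; field_simp
  have e2 : Real.log (1 - -(ω / b)) = Real.log (b + ω) - Real.log b := by
    rw [← Real.log_div (by linarith) hb.ne']; congr 1; field_simp; ring
  rw [← hasSum_nat_add_iff' 1]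
  convert (s1.add s2).neg using 1
  · funext n
    simp only [powFP, Nat.add_one_ne_zero, if_false]
    rw [neg_pow (ω / b), div_pow]
    push_cast
    field_simp
    ring
  · rw [e1, e2]
    simp [powFP]
    ring

theorem reflQuot_factor {f q : ℝ → ℂ} {ω x : ℝ} (hx : x ≠ 0) (k : ℕ)
    (h1 : f x = f ω + ((x : ℂ) - ω) * q x)
    (h2 : f (-x) = f ω + (((-x : ℝ) : ℂ) - ω) * q (-x)) :
    reflQuot f (k + 1) x = f ω * ((-1) ^ k + 1) * ((x : ℂ) ^ (k + 1))⁻¹ +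
      (reflQuot q k x + -ω * reflQuot q (k + 1) x) := by
  have hx' : (x : ℂ) ≠ 0 := by exact_mod_cast hx
  simp only [reflQuot]
  rw [h1, h2]
  push_cast
  field_simp
  ring

theorem hasSum_and_hasPVTo {f : ℝ → ℂ} {T : ℕ → ℂ} {ω h b : ℝ} (hωh : |ω| < h) (hhb : h ≤ b)
    (hω : ω ≠ 0 ∨ f ω = 0) (hc : ContinuousOn f (Set.Icc (-b) b)) (hf : ExtendsToDisc f h)
    (hT : ∀ k, HasFinitePartTo (reflQuot f (k + 1)) b (T k)) :
    ∃ S, HasSum (fun k => (ω : ℂ) ^ k * T k) S ∧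
      HasPVTo (fun x : ℝ => ((Real.sign x : ℝ) : ℂ) * f x / ((ω : ℂ) - (x : ℂ))) ω b
        (-S + 2 * f ω * (Real.log |ω| : ℂ)) := by
  have hh : 0 < h := (abs_nonneg ω).trans_lt hωh
  have hb : 0 < b := hh.trans_le hhb
  have hωb : |ω| < b := hωh.trans_le hhb
  obtain ⟨q, hqc, hq, hfq⟩ := exists_factor hωh hc hf
  obtain ⟨U, C, hU⟩ := exists_hasFinitePartTo_reflQuot hh hhb hqc hq
  -- `T` does not depend on `ω`, whereas `q` and `U` do; uniqueness of the finite part reconciles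
  -- them.
  have hTU : ∀ k, T k = f ω * ((-1) ^ k + 1) * (powFP b k : ℂ) + (U k + -ω * U (k + 1)) := by
    intro k
    refine (hT k).unique ((((hasFinitePartTo_pow hb k).const_mul _).add
      ((hU k).1.add ((hU (k + 1)).1.const_mul _))).congr hb fun x hx hxb => ?_)
    exact (reflQuot_factor hx.ne' k (hfq x (by rwa [abs_of_pos hx]))
      (hfq (-x) (by rwa [abs_neg, abs_of_pos hx]))).symm
  have hU0 : U 0 = ∫ x in (0 : ℝ)..b, (q x - q (-x)) := by
    have hi : IntervalIntegrable (fun x => q x - q (-x)) volume 0 b := by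
      refine ContinuousOn.intervalIntegrable ?_
      rw [Set.uIcc_of_le hb.le]
      refine (hqc.mono (Set.Icc_subset_Icc_left (by linarith))).sub
        (hqc.comp (by fun_prop) fun x hx => ⟨by linarith [hx.2], by linarith [hx.1]⟩)
    refine (hU 0).1.unique ((HasFinitePartTo.of_intervalIntegrable hb hi).congr hb fun x _ _ => ?_)
    simp only [reflQuot]
    ring
  have s1 : HasSum (fun k : ℕ => f ω * (((ω ^ k * (((-1) ^ k + 1) * powFP b k) : ℝ)) : ℂ))
      (f ω * ((Real.log (b - ω) + Real.log (b + ω) : ℝ) : ℂ)) :=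
    (Complex.hasSum_ofReal.2 (hasSum_powFP hωb)).mul_left _
  have s2 := hasSum_sub_succ (summable_pow_mul_of_bound hωh fun k => (hU k).2)
  refine ⟨f ω * ((Real.log (b - ω) + Real.log (b + ω) : ℝ) : ℂ) + U 0, ?_, ?_⟩
  · convert s1.add s2 using 1
    · funext k
      rw [hTU k]
      push_cast
      ring
    · simp
  · convert hasPVTo_of_factor hωb hω hqc hfq using 1
    rw [hU0]
    push_cast
    ring

/-! ### Passage to the infinite interval -/

theorem exists_bound_of_tendsto_atTop {U : ℝ → ℂ} {h : ℝ} {L : ℂ}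
    (hU : ContinuousOn U (Set.Ici h)) (hL : Tendsto U atTop (𝓝 L)) :
    ∃ C, ∀ b, h ≤ b → ‖U b‖ ≤ C := by
  obtain ⟨B, hB⟩ := eventually_atTop.1 (hL.norm.eventually_le_const (lt_add_one ‖L‖))
  obtain ⟨M, hM⟩ := (isCompact_Icc (a := h) (b := B)).exists_bound_of_continuousOn
    (hU.mono Set.Icc_subset_Ici_self)
  refine ⟨max M (‖L‖ + 1), fun b hb => ?_⟩
  rcases le_total b B with h1 | h1
  · exact (hM b ⟨hb, h1⟩).trans (le_max_left _ _)
  · exact (hB b h1).trans (le_max_right _ _)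

theorem intervalIntegrable_of_continuousOn_Ici {u : ℝ → ℂ} {h b : ℝ}
    (hu : ContinuousOn u (Set.Ici h)) (hb : h ≤ b) : IntervalIntegrable u volume h b := by
  refine (hu.mono ?_).intervalIntegrable
  rw [Set.uIcc_of_le hb]
  exact Set.Icc_subset_Ici_self

/-- Dirichlet's test made quantitative. The primitive `U` of `u` is bounded by some `C`, and
integration by parts leaves `C b^(-n)` from the boundary plus `C (h^(-n) - b^(-n))` from the
integral, exactly `C h^(-n)`. -/
theorem exists_bound_integral_mul_inv_pow {u : ℝ → ℂ} {h : ℝ} {L : ℂ} (hh : 0 < h)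
    (hu : ContinuousOn u (Set.Ici h))
    (hL : Tendsto (fun b => ∫ x in h..b, u x) atTop (𝓝 L)) :
    ∃ C, ∀ n : ℕ, (∃ M, Tendsto (fun b => ∫ x in h..b, ((x : ℂ) ^ n)⁻¹ * u x) atTop (𝓝 M)) ∧
      ∀ b, h ≤ b → ‖∫ x in h..b, ((x : ℂ) ^ n)⁻¹ * u x‖ ≤ C * (h ^ n)⁻¹ := by
  set U : ℝ → ℂ := fun b => ∫ x in h..b, u x with hUdef
  have hUc : ContinuousOn U (Set.Ici h) := by
    intro b hb
    have hb : h ≤ b := hb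
    have h1 := intervalIntegral.continuousOn_primitive_interval' (μ := volume)
      (intervalIntegrable_of_continuousOn_Ici hu (hb.trans (le_add_of_nonneg_right zero_le_one)))
      Set.left_mem_uIcc
    rw [Set.uIcc_of_le (hb.trans (le_add_of_nonneg_right zero_le_one))] at h1
    refine (h1 b ⟨hb, by linarith⟩).mono_of_mem_nhdsWithin ?_
    filter_upwards [self_mem_nhdsWithin,
      nhdsWithin_le_nhds (Iio_mem_nhds (lt_add_one b))] with y h2 h3 using ⟨h2, le_of_lt h3⟩
  have hUd : ∀ x, h < x → HasDerivAt U (u x) x := by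
    intro x hx
    refine intervalIntegral.integral_hasDerivAt_right
      (intervalIntegrable_of_continuousOn_Ici hu hx.le) ?_
      (hu.continuousAt (Ici_mem_nhds hx))
    exact (hu.mono Set.Ioi_subset_Ici_self).stronglyMeasurableAtFilter isOpen_Ioi x hx
  obtain ⟨C, hC⟩ := exists_bound_of_tendsto_atTop hUc hL
  have hC0 : 0 ≤ C := (norm_nonneg _).trans (hC h le_rfl)
  refine ⟨C, fun n => ?_⟩
  rcases Nat.eq_zero_or_pos n with rfl | hn
  · simpa using ⟨⟨L, hL⟩, hC⟩
  have hn' : (n : ℝ) ≠ 0 := by exact_mod_cast hn.ne'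
  -- This is `x ^ (-n)`, written so that its derivative comes from `hasDerivAt_powFP`.
  set w : ℝ → ℂ := fun x => (((-n * powFP x n : ℝ)) : ℂ) with hw
  have hwe : ∀ x, w x = ((x : ℂ) ^ n)⁻¹ := by
    intro x
    simp only [hw, powFP, hn.ne', if_false]
    rw [mul_inv, neg_mul_neg, mul_inv_cancel_left₀ hn']
    push_cast; rfl
  set w' : ℝ → ℂ := fun x => ((-n * (x ^ (n + 1))⁻¹ : ℝ) : ℂ) with hw'
  have hwd : ∀ x, x ≠ 0 → HasDerivAt w (w' x) x := fun x hx =>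
    ((hasDerivAt_powFP n hx).const_mul (-n : ℝ)).ofReal_comp
  have hwc : ContinuousOn w (Set.Ici h) := fun x hx =>
    (hwd x (hh.trans_le hx).ne').continuousAt.continuousWithinAt
  have hrc : ContinuousOn (fun x : ℝ => (x ^ (n + 1))⁻¹) (Set.Ici h) :=
    ContinuousOn.inv₀ (by fun_prop) fun x hx => pow_ne_zero _ (hh.trans_le hx).ne'
  have hw'c : ContinuousOn w' (Set.Ici h) :=
    Complex.continuous_ofReal.comp_continuousOn (continuousOn_const.mul hrc)
  have hparts : ∀ b, h ≤ b → ∫ x in h..b, ((x : ℂ) ^ n)⁻¹ * u x =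
      ((b : ℂ) ^ n)⁻¹ * U b - ∫ x in h..b, w' x * U x := by
    intro b hb
    simp only [← hwe]
    have hsub : Set.uIcc h b ⊆ Set.Ici h := by
      rw [Set.uIcc_of_le hb]; exact Set.Icc_subset_Ici_self
    rw [intervalIntegral.integral_mul_deriv_eq_deriv_mul_of_hasDerivAt (hwc.mono hsub)
      (hUc.mono hsub) (u' := w') ?_ ?_ (intervalIntegrable_of_continuousOn_Ici hw'c hb)
      (intervalIntegrable_of_continuousOn_Ici hu hb)]
    · simp [hUdef]
    · intro x hx
      rw [min_eq_left hb] at hx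
      exact hwd x (hh.trans hx.1).ne'
    · intro x hx
      rw [min_eq_left hb] at hx
      exact hUd x hx.1
  have hnorm : ∀ b, h ≤ b → ∫ x in h..b, ‖w' x * U x‖ ≤ C * ((h ^ n)⁻¹ - (b ^ n)⁻¹) := by
    intro b hb
    have h1 : ∫ x in h..b, (C * n) * (x ^ (n + 1))⁻¹ = C * ((h ^ n)⁻¹ - (b ^ n)⁻¹) := by
      rw [intervalIntegral.integral_const_mul,
        intervalIntegral.integral_eq_sub_of_hasDerivAt (f := fun x => powFP x n)]
      · simp only [powFP, hn.ne', if_false]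
        field_simp
        ring
      · intro x hx
        rw [Set.uIcc_of_le hb] at hx
        exact hasDerivAt_powFP n (hh.trans_le hx.1).ne'
      · refine (hrc.mono ?_).intervalIntegrable
        rw [Set.uIcc_of_le hb]; exact Set.Icc_subset_Ici_self
    rw [← h1]
    refine intervalIntegral.integral_mono_on hb
      (intervalIntegrable_of_continuousOn_Ici (hw'c.mul hUc) hb).norm ?_ fun x hx => ?_
    · refine ((continuousOn_const.mul hrc).mono ?_).intervalIntegrable
      rw [Set.uIcc_of_le hb]; exact Set.Icc_subset_Ici_self
    · have hx0 : 0 < x := hh.trans_le hx.1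
      rw [norm_mul, hw', Complex.norm_real, Real.norm_eq_abs, neg_mul, abs_neg,
        abs_of_nonneg (by positivity)]
      have := hC x hx.1
      calc (n : ℝ) * (x ^ (n + 1))⁻¹ * ‖U x‖ ≤ n * (x ^ (n + 1))⁻¹ * C := by gcongr
        _ = _ := by ring
  constructor
  · have hint : IntegrableOn (fun x => w' x * U x) (Set.Ioi h) := by
      refine integrableOn_Ioi_of_intervalIntegral_norm_bounded (l := atTop) (b := id)
        (C * (h ^ n)⁻¹) h (fun b => ?_) tendsto_id ?_
      · exact ((hw'c.mul hUc).mono Set.Icc_subset_Ici_self).integrableOn_Icc.mono_set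
          Set.Ioc_subset_Icc_self
      · filter_upwards [eventually_ge_atTop h] with b hb
        refine (hnorm b hb).trans ?_
        have : 0 < b := hh.trans_le hb
        gcongr
        exact sub_le_self _ (by positivity)
    have h1 : Tendsto (fun b : ℝ => ((b : ℂ) ^ n)⁻¹) atTop (𝓝 0) := by
      have := tendsto_ofReal_zero (tendsto_inv_atTop_zero.comp (tendsto_pow_atTop hn.ne'
        (α := ℝ)))
      simpa using this
    refine ⟨_, ((h1.mul hL).sub (intervalIntegral_tendsto_integral_Ioi h hint tendsto_id)).congr' ?_⟩
    filter_upwards [eventually_ge_atTop h] with b hb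
    exact (hparts b hb).symm
  · intro b hb
    have hb0 : 0 < b := hh.trans_le hb
    rw [hparts b hb]
    have h1 : ‖((b : ℂ) ^ n)⁻¹ * U b‖ ≤ C * (b ^ n)⁻¹ := by
      rw [norm_mul, norm_inv, norm_pow, Complex.norm_real, Real.norm_of_nonneg hb0.le, mul_comm]
      gcongr
      exact hC b hb
    have h2 := (intervalIntegral.norm_integral_le_integral_norm
      (f := fun x => w' x * U x) (μ := volume) hb).trans (hnorm b hb)
    refine (norm_sub_le _ _).trans ?_
    linarith

/-- The function `x ↦ φ x + φ (-x)` for `φ x = sgn(x) f(x) / (ω - x)`, at `x > 0`. -/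
noncomputable def foldedKernel (f : ℝ → ℂ) (ω x : ℝ) : ℂ :=
  f x / ((ω : ℂ) - x) - f (-x) / ((ω : ℂ) + x)

theorem continuousOn_foldedKernel {f : ℝ → ℂ} {ω h : ℝ} (hf : Continuous f) (hωh : |ω| < h) :
    ContinuousOn (foldedKernel f ω) (Set.Ici h) := by
  obtain ⟨h1, h2⟩ := abs_lt.1 hωh
  refine ContinuousOn.sub ?_ ?_
  · refine ContinuousOn.div hf.continuousOn (by fun_prop) fun x hx => ?_
    have hx : h ≤ x := hx
    exact sub_ne_zero.2 (by exact_mod_cast (h2.trans_le hx).ne)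
  · refine ContinuousOn.div (by fun_prop) (by fun_prop) fun x hx => ?_
    have hx : h ≤ x := hx
    have : ω + x ≠ 0 := (show 0 < ω + x by linarith).ne'
    exact_mod_cast this

theorem integral_foldedKernel {f : ℝ → ℂ} {ω h b : ℝ} (hf : Continuous f) (hωh : |ω| < h)
    (hb : h ≤ b) :
    IntervalIntegrable (fun x : ℝ => ((Real.sign x : ℝ) : ℂ) * f x / ((ω : ℂ) - (x : ℂ)))
      volume (-b) (-h) ∧
    IntervalIntegrable (fun x : ℝ => ((Real.sign x : ℝ) : ℂ) * f x / ((ω : ℂ) - (x : ℂ)))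
      volume h b ∧
    (∫ x in (-b)..(-h), ((Real.sign x : ℝ) : ℂ) * f x / ((ω : ℂ) - (x : ℂ))) +
      (∫ x in h..b, ((Real.sign x : ℝ) : ℂ) * f x / ((ω : ℂ) - (x : ℂ))) =
      ∫ x in h..b, foldedKernel f ω x := by
  have hh : 0 < h := (abs_nonneg ω).trans_lt hωh
  obtain ⟨h1, h2⟩ := abs_lt.1 hωh
  have hint : ∀ c d : ℝ, (∀ x ∈ Set.uIcc c d, x ≠ ω) → IntervalIntegrable
      (fun x : ℝ => ((Real.sign x : ℝ) : ℂ) * f x / ((ω : ℂ) - (x : ℂ))) volume c d := by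
    intro c d hcd
    simp only [mul_div_assoc]
    refine intervalIntegrable_sign_mul (ContinuousOn.div hf.continuousOn (by fun_prop)
      fun x hx => sub_ne_zero.2 (by exact_mod_cast (hcd x hx).symm))
  have i1 := hint (-b) (-h) fun x hx => by
    rw [Set.uIcc_of_le (by linarith)] at hx
    exact (lt_of_le_of_lt hx.2 h1).ne
  have i2 := hint h b fun x hx => by
    rw [Set.uIcc_of_le hb] at hx
    exact (h2.trans_le hx.1).ne'
  refine ⟨i1, i2, ?_⟩
  have i3 := i1.comp_sub_left 0
  simp only [sub_neg_eq_add, zero_add, zero_sub] at i3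
  rw [← intervalIntegral.integral_comp_neg, ← intervalIntegral.integral_add i3.symm i2]
  refine intervalIntegral.integral_congr fun x hx => ?_
  rw [Set.uIcc_of_le hb] at hx
  have hx0 : 0 < x := hh.trans_le hx.1
  simp only [foldedKernel, Real.sign_neg, Real.sign_of_pos hx0]
  push_cast
  ring

/-- The folded integral over `[h, b]` is the principal value over `[-b, b]` minus the one over `[-h,
h]`. -/
theorem tendsto_integral_foldedKernel {f : ℝ → ℂ} {ω h : ℝ} (hf : Continuous f) (hωh : |ω| < h)
    (hω : ω ≠ 0) (hext : ExtendsToDisc f h) (hPV : ∃ L, HasSgnHilbert f ∞ ω L) :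
    ∃ L, Tendsto (fun b => ∫ x in h..b, foldedKernel f ω x) atTop (𝓝 L) := by
  have hh : 0 < h := (abs_nonneg ω).trans_lt hωh
  obtain ⟨U, C, hU⟩ := exists_hasFinitePartTo_reflQuot hh le_rfl hf.continuousOn hext
  obtain ⟨S, -, hS⟩ := hasSum_and_hasPVTo hωh le_rfl (Or.inl hω) hf.continuousOn hext
    fun k => (hU (k + 1)).1
  obtain ⟨L, h0 | ⟨-, v, hv, hvL⟩⟩ := hPV
  · exact absurd rfl h0.1
  · refine ⟨_, (hvL.sub_const (-S + 2 * f ω * (Real.log |ω| : ℂ))).congr' ?_⟩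
    filter_upwards [hv, eventually_ge_atTop h] with b hvb hb
    obtain ⟨i1, i2, i3⟩ := integral_foldedKernel hf hωh hb
    rw [hvb.unique (hS.extend i1 i2), i3]
    ring

theorem tendsto_integral_linearCombination {u v : ℝ → ℂ} {h : ℝ} {L M : ℂ} (r s : ℂ)
    (hu : ContinuousOn u (Set.Ici h)) (hv : ContinuousOn v (Set.Ici h))
    (hL : Tendsto (fun b => ∫ x in h..b, u x) atTop (𝓝 L))
    (hM : Tendsto (fun b => ∫ x in h..b, v x) atTop (𝓝 M)) :
    Tendsto (fun b => ∫ x in h..b, (r * u x + s * v x)) atTop (𝓝 (r * L + s * M)) := by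
  refine ((hL.const_mul r).add (hM.const_mul s)).congr' ?_
  filter_upwards [eventually_ge_atTop h] with b hb
  rw [intervalIntegral.integral_add, intervalIntegral.integral_const_mul,
    intervalIntegral.integral_const_mul]
  · exact (intervalIntegrable_of_continuousOn_Ici hu hb).const_mul r
  · exact (intervalIntegrable_of_continuousOn_Ici hv hb).const_mul s

/-- Here `e = (1 - ω²/x²) u`. Its integral converges because those of `u` and `x^(-2) u` do, so the
integration by parts bound can be applied again, to `e`. -/
theorem exists_bound_of_rational_factor {u e : ℝ → ℂ} {ω h : ℝ} {L : ℂ} (hh : 0 < h)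
    (hu : ContinuousOn u (Set.Ici h))
    (hL : Tendsto (fun b => ∫ x in h..b, u x) atTop (𝓝 L))
    (he : ∀ x, h ≤ x → e x = u x - (ω : ℂ) ^ 2 * (((x : ℂ) ^ 2)⁻¹ * u x)) :
    ∃ C, ∀ n : ℕ, (∃ M, Tendsto (fun b => ∫ x in h..b, ((x : ℂ) ^ n)⁻¹ * e x) atTop (𝓝 M)) ∧
      ∀ b, h ≤ b → ‖∫ x in h..b, ((x : ℂ) ^ n)⁻¹ * e x‖ ≤ C * (h ^ n)⁻¹ := by
  obtain ⟨C, hC⟩ := exists_bound_integral_mul_inv_pow hh hu hL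
  obtain ⟨M, hM⟩ := (hC 2).1
  have hw : ContinuousOn (fun x : ℝ => ((x : ℂ) ^ 2)⁻¹ * u x) (Set.Ici h) := by
    refine ContinuousOn.mul (ContinuousOn.inv₀ (by fun_prop) fun x hx => ?_) hu
    exact pow_ne_zero _ (by exact_mod_cast (hh.trans_le hx).ne')
  have he' : ∀ x, h ≤ x →
      e x = 1 * u x + (-(ω : ℂ) ^ 2) * (((x : ℂ) ^ 2)⁻¹ * u x) := fun x hx => by
    rw [he x hx]; ring
  refine exists_bound_integral_mul_inv_pow hh (L := 1 * L + (-(ω : ℂ) ^ 2) * M) ?_ ?_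
  · exact ((continuousOn_const.mul hu).add (continuousOn_const.mul hw)).congr fun x hx => he' x hx
  · refine (tendsto_integral_linearCombination 1 (-(ω : ℂ) ^ 2) hu hw hL hM).congr' ?_
    filter_upwards [eventually_ge_atTop h] with b hb
    refine intervalIntegral.integral_congr fun x hx => ?_
    rw [Set.uIcc_of_le hb] at hx
    exact (he' x hx.1).symm

theorem exists_bound_integral_reflQuot {f : ℝ → ℂ} {h : ℝ} (hh : 0 < h) (hf : Continuous f)
    (hext : ExtendsToDisc f h)
    (hPV : ∀ ω : ℝ, ω ≠ 0 → |ω| < h → ∃ L, HasSgnHilbert f ∞ ω L) :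
    ∃ C, ∀ k : ℕ, (∃ M, Tendsto (fun b => ∫ x in h..b, reflQuot f (k + 1) x) atTop (𝓝 M)) ∧
      ∀ b, h ≤ b → ‖∫ x in h..b, reflQuot f (k + 1) x‖ ≤ C * (h ^ k)⁻¹ := by
  set ω : ℝ := h / 2 with hωdef
  have hω0 : 0 < ω := by positivity
  have hωh : |ω| < h := by rw [abs_of_pos hω0]; linarith
  have hωh' : |(-ω)| < h := by rwa [abs_neg]
  have c1 := continuousOn_foldedKernel hf hωh
  have c2 := continuousOn_foldedKernel hf hωh'
  obtain ⟨L, hL⟩ := tendsto_integral_foldedKernel hf hωh hω0.ne' hext (hPV _ hω0.ne' hωh)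
  obtain ⟨M, hM⟩ := tendsto_integral_foldedKernel hf hωh' (neg_ne_zero.2 hω0.ne') hext
    (hPV _ (neg_ne_zero.2 hω0.ne') hωh')
  have hωc : (ω : ℂ) ≠ 0 := by exact_mod_cast hω0.ne'
  have hne : ∀ x, h ≤ x → (x : ℂ) ≠ 0 ∧ (ω : ℂ) - x ≠ 0 ∧ (ω : ℂ) + x ≠ 0 := by
    intro x hx
    refine ⟨?_, ?_, ?_⟩
    · exact_mod_cast (hh.trans_le hx).ne'
    · refine sub_ne_zero.2 ?_
      exact_mod_cast (show ω < x by linarith).ne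
    · exact_mod_cast (show 0 < ω + x by linarith).ne'
  -- The half-sum of the folded kernels at `±ω` is `-x (f x + f (-x)) / (x² - ω²)`, and their
  -- difference is `-2ω (f x - f (-x)) / (x² - ω²)`. The factor `1 - ω²/x²` clears the denominators,
  -- giving the even-`k` and odd-`k` integrands up to powers of `x²`.
  obtain ⟨C, hC⟩ := exists_bound_of_rational_factor (ω := ω)
    (u := fun x => -1 / 2 * foldedKernel f ω x + -1 / 2 * foldedKernel f (-ω) x)
    (e := fun x => (f x + f (-x)) / x) hh
    ((continuousOn_const.mul c1).add (continuousOn_const.mul c2))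
    (tendsto_integral_linearCombination (-1 / 2) (-1 / 2) c1 c2 hL hM) (by
      intro x hx
      obtain ⟨n1, n2, n3⟩ := hne x hx
      have n4 : -(ω : ℂ) - x ≠ 0 := fun h => n3 (by linear_combination -h)
      have n5 : -(ω : ℂ) + x ≠ 0 := fun h => n2 (by linear_combination -h)
      simp only [foldedKernel]
      push_cast
      field_simp
      ring)
  obtain ⟨D, hD⟩ := exists_bound_of_rational_factor (ω := ω)
    (u := fun x => -1 / (2 * ω) * foldedKernel f ω x + 1 / (2 * ω) * foldedKernel f (-ω) x)
    (e := fun x => (f x - f (-x)) / (x : ℂ) ^ 2) hh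
    ((continuousOn_const.mul c1).add (continuousOn_const.mul c2))
    (tendsto_integral_linearCombination (-1 / (2 * ω)) (1 / (2 * ω)) c1 c2 hL hM) (by
      intro x hx
      obtain ⟨n1, n2, n3⟩ := hne x hx
      have n4 : -(ω : ℂ) - x ≠ 0 := fun h => n3 (by linear_combination -h)
      have n5 : -(ω : ℂ) + x ≠ 0 := fun h => n2 (by linear_combination -h)
      simp only [foldedKernel]
      push_cast
      field_simp
      ring)
  have hC0 : 0 ≤ C := by simpa using (norm_nonneg _).trans ((hC 0).2 h le_rfl)
  have hD0 : 0 ≤ D := by simpa using (norm_nonneg _).trans ((hD 0).2 h le_rfl)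
  refine ⟨C + D * h, fun k => ?_⟩
  have hp : 0 < (h ^ k)⁻¹ := by positivity
  rcases Nat.even_or_odd' k with ⟨j, rfl | rfl⟩
  · have e : reflQuot f (2 * j + 1) = fun x : ℝ => ((x : ℂ) ^ (2 * j))⁻¹ * ((f x + f (-x)) / x) := by
      funext x
      have : ((-1 : ℂ)) ^ (2 * j + 1 + 1) = 1 := by
        rw [pow_add, pow_add, pow_mul]; norm_num
      rw [reflQuot, this, pow_succ, div_eq_mul_inv, mul_inv, div_eq_mul_inv]
      ring
    rw [e]
    refine ⟨(hC _).1, fun b hb => ((hC _).2 b hb).trans ?_⟩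
    gcongr
    linarith [mul_nonneg hD0 hh.le]
  · have e : reflQuot f (2 * j + 1 + 1) =
        fun x : ℝ => ((x : ℂ) ^ (2 * j))⁻¹ * ((f x - f (-x)) / (x : ℂ) ^ 2) := by
      funext x
      have : ((-1 : ℂ)) ^ (2 * j + 1 + 1 + 1) = -1 := by
        rw [pow_add, pow_add, pow_add, pow_mul]; norm_num
      rw [reflQuot, this, add_assoc, pow_add, div_eq_mul_inv, mul_inv, div_eq_mul_inv]
      ring
    rw [e]
    refine ⟨(hD _).1, fun b hb => ((hD _).2 b hb).trans ?_⟩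
    have : (h ^ (2 * j))⁻¹ = h * (h ^ (2 * j + 1))⁻¹ := by
      rw [pow_succ]; field_simp
    rw [this, ← mul_assoc]
    gcongr
    linarith

/-- The bound `‖T b k‖ ≤ C h^(-k)` is uniform in `b ≥ h`, so for `|ω| < h` a geometric series
dominates and the finite-interval formula passes to the limit termwise. -/
theorem hasSum_and_hasSgnHilbert_top {f : ℝ → ℂ} {T : ℝ → ℕ → ℂ} {h : ℝ} (hh : 0 < h)
    (hf : Continuous f) (hext : ExtendsToDisc f h)
    (hPV : ∀ ω : ℝ, ω ≠ 0 → |ω| < h → ∃ L, HasSgnHilbert f ∞ ω L)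
    (hT : ∀ b, h ≤ b → ∀ k, HasFinitePartTo (reflQuot f (k + 1)) b (T b k)) :
    ∃ T' : ℕ → ℂ, (∀ k, Tendsto (fun b => T b k) atTop (𝓝 (T' k))) ∧
      ∀ ω : ℝ, |ω| < h → (ω ≠ 0 ∨ f ω = 0) → ∃ S, HasSum (fun k => (ω : ℂ) ^ k * T' k) S ∧
        HasSgnHilbert f ∞ ω (-S + 2 * f ω * (Real.log |ω| : ℂ)) := by
  obtain ⟨U, C, hU⟩ := exists_hasFinitePartTo_reflQuot hh le_rfl hf.continuousOn hext
  obtain ⟨D, hD⟩ := exists_bound_integral_reflQuot hh hf hext hPV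
  have hTU : ∀ k b, h ≤ b → T b k = U (k + 1) + ∫ x in h..b, reflQuot f (k + 1) x := by
    intro k b hb
    refine (hT b hb k).unique ((hU (k + 1)).1.extend (ContinuousOn.intervalIntegrable ?_))
    rw [Set.uIcc_of_le hb]
    exact continuousOn_reflQuot hh hf.continuousOn _
  choose M hM using fun k => (hD k).1
  have hlim : ∀ k, Tendsto (fun b => T b k) atTop (𝓝 (U (k + 1) + M k)) := by
    intro k
    refine ((hM k).const_add (U (k + 1))).congr' ?_
    filter_upwards [eventually_ge_atTop h] with b hb using (hTU k b hb).symm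
  have hbound : ∀ k b, h ≤ b → ‖T b k‖ ≤ (C * h⁻¹ + D) * (h ^ k)⁻¹ := by
    intro k b hb
    rw [hTU k b hb]
    refine (norm_add_le _ _).trans ?_
    rw [add_mul]
    refine add_le_add ((hU (k + 1)).2.trans_eq ?_) ((hD k).2 b hb)
    rw [pow_succ, mul_inv]; ring
  refine ⟨fun k => U (k + 1) + M k, hlim, fun ω hωh hω => ?_⟩
  have hbound' : ∀ k, ‖U (k + 1) + M k‖ ≤ (C * h⁻¹ + D) * (h ^ k)⁻¹ := fun k =>
    le_of_tendsto (hlim k).norm <| by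
      filter_upwards [eventually_ge_atTop h] with b hb using hbound k b hb
  refine ⟨_, (summable_pow_mul_of_bound hωh hbound').hasSum, Or.inr ⟨rfl,
    fun b => -(∑' k, (ω : ℂ) ^ k * T b k) + 2 * f ω * (Real.log |ω| : ℂ), ?_, ?_⟩⟩
  · filter_upwards [eventually_ge_atTop h] with b hb
    obtain ⟨S, hS1, hS2⟩ := hasSum_and_hasPVTo hωh hb hω hf.continuousOn hext (hT b hb)
    rwa [hS1.tsum_eq]
  · refine (Tendsto.neg ?_).add_const _
    have hs : Summable fun k : ℕ => (C * h⁻¹ + D) * (|ω| / h) ^ k :=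
      (summable_geometric_of_lt_one (by positivity) ((div_lt_one hh).2 hωh)).mul_left _
    refine tendsto_tsum_of_dominated_convergence hs (fun k => (hlim k).const_mul _) ?_
    filter_upwards [eventually_ge_atTop h] with b hb k
    rw [norm_mul, norm_pow, Complex.norm_real, Real.norm_eq_abs, div_pow]
    calc |ω| ^ k * ‖T b k‖ ≤ |ω| ^ k * ((C * h⁻¹ + D) * (h ^ k)⁻¹) := by
          gcongr; exact hbound k b hb
      _ = _ := by ring

/-! ### The singularity distance and the common formula for every `a` -/

theorem mem_symInterval {a : ℝ≥0∞} {b x : ℝ} (hb : ENNReal.ofReal b ≤ a) (hx : |x| ≤ b) :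
    x ∈ symInterval a := by
  rw [symInterval, Set.mem_ofPred_eq, Real.enorm_eq_ofReal_abs]
  exact (ENNReal.ofReal_le_ofReal hx).trans hb

theorem ComplexAnalyticOn.continuousOn {f : ℝ → ℂ} {I : Set ℝ} (hf : ComplexAnalyticOn f I) :
    ContinuousOn f I := by
  obtain ⟨F, hF, hFf⟩ := hf
  intro x hx
  have h1 : ContinuousAt (fun y : ℝ => F y) x :=
    ContinuousAt.comp (f := fun y : ℝ => (y : ℂ)) (hF x hx).continuousAt
      Complex.continuous_ofReal.continuousAt
  exact h1.continuousWithinAt.congr (fun y hy => (hFf y hy).symm) (hFf x hx).symm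

theorem ComplexAnalyticOn.continuousOn_Icc {f : ℝ → ℂ} {a : ℝ≥0∞} {b : ℝ}
    (hf : ComplexAnalyticOn f (symInterval a)) (hb : ENNReal.ofReal b ≤ a) :
    ContinuousOn f (Set.Icc (-b) b) :=
  hf.continuousOn.mono fun _ hx => mem_symInterval hb (abs_le.2 hx)

theorem analyticAt_comp_ofReal {F : ℂ → ℂ} {x : ℝ} (hF : AnalyticAt ℂ F x) :
    AnalyticAt ℝ (fun y : ℝ => F y) x :=
  (hF.restrictScalars (𝕜 := ℝ)).comp (Complex.ofRealCLM.analyticAt x)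

/-- The extension to the disc agrees with `f` only near `0` by definition; the identity theorem for
real-analytic functions on `[-h, h]` carries the agreement to the whole interval. -/
theorem extendsToDisc_of_lt_singularityDist {f : ℝ → ℂ} {a : ℝ≥0∞} {h : NNReal} (hh : 0 < h)
    (hf : ComplexAnalyticOn f (symInterval a)) (ha : (h : ℝ≥0∞) ≤ a)
    (hρ : (h : ℝ≥0∞) < singularityDist f) : ExtendsToDisc f h := by
  obtain ⟨r, ⟨F, hF, hFf⟩, hr⟩ := lt_sSup_iff.1 hρ
  obtain ⟨R, hhR, hRr⟩ := ENNReal.lt_iff_exists_nnreal_btwn.1 hr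
  have hhR' : (h : ℝ) < R := by exact_mod_cast hhR
  have hball : ∀ z ∈ Metric.ball (0 : ℂ) R, AnalyticAt ℂ F z := by
    intro z hz
    refine hF z (lt_trans ?_ hRr)
    rw [mem_ball_zero_iff] at hz
    rw [enorm_lt_coe]
    exact_mod_cast hz
  refine ⟨R, hhR', F, fun z hz => (hball z hz).differentiableAt.differentiableWithinAt, ?_⟩
  obtain ⟨G, hG, hGf⟩ := hf
  have ha' : ENNReal.ofReal (h : ℝ) ≤ a := by simpa using ha
  have hmem : ∀ x ∈ Set.Icc (-(h : ℝ)) h, x ∈ symInterval a :=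
    fun x hx => mem_symInterval ha' (abs_le.2 hx)
  have hh' : (0 : ℝ) < h := by exact_mod_cast hh
  have key : Set.EqOn (fun x : ℝ => F x) (fun x : ℝ => G x) (Set.Icc (-(h : ℝ)) h) := by
    refine AnalyticOnNhd.eqOn_of_preconnected_of_eventuallyEq (𝕜 := ℝ) (z₀ := 0)
      (fun x hx => analyticAt_comp_ofReal (hball x ?_))
      (fun x hx => analyticAt_comp_ofReal (hG x (hmem x hx))) isPreconnected_Icc
      ⟨by linarith, hh'.le⟩ ?_
    · rw [mem_ball_zero_iff, Complex.norm_real, Real.norm_eq_abs]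
      exact (abs_le.2 hx).trans_lt hhR'
    · filter_upwards [hFf, Icc_mem_nhds (neg_lt_zero.2 hh') hh'] with x h1 h2
      rw [h1, hGf x (hmem x h2)]
  intro x hx
  have := key (abs_le.1 hx)
  simp only at this
  rw [this, hGf x (mem_symInterval ha' hx)]

theorem singularityDist_pos {f : ℝ → ℂ} {a : ℝ≥0∞} (ha : 0 < a)
    (hf : ComplexAnalyticOn f (symInterval a)) : 0 < singularityDist f := by
  obtain ⟨G, hG, hGf⟩ := hf
  have h0 : AnalyticAt ℂ G 0 := by simpa using hG 0 (by simp [symInterval])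
  obtain ⟨ε, hε, hball⟩ := Metric.eventually_nhds_iff.1 h0.eventually_analyticAt
  refine lt_of_lt_of_le (ENNReal.ofReal_pos.2 hε) (le_sSup ⟨G, fun z hz => hball ?_, ?_⟩)
  · rw [dist_zero_right]
    rw [← ofReal_norm, ENNReal.ofReal_lt_ofReal_iff hε] at hz
    exact hz
  · obtain ⟨r, hr, hra⟩ := ENNReal.lt_iff_exists_nnreal_btwn.1 ha
    have hr' : (0 : ℝ) < r := by exact_mod_cast hr
    filter_upwards [Icc_mem_nhds (neg_lt_zero.2 hr') hr'] with x hx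
    exact hGf x (mem_symInterval (b := r) (by simpa using hra.le) (abs_le.2 hx))

theorem exists_nnreal_btwn {ω : ℝ} {c : ℝ≥0∞} (h : ‖ω‖ₑ < c) :
    ∃ r : NNReal, |ω| < r ∧ (r : ℝ≥0∞) < c := by
  obtain ⟨r, h1, h2⟩ := ENNReal.lt_iff_exists_nnreal_btwn.1 h
  refine ⟨r, ?_, h2⟩
  rw [enorm_lt_coe] at h1
  exact_mod_cast h1

theorem exists_hasFinitePart_hasSgnHilbert {a : ℝ≥0∞} (ha : 0 < a) {f : ℝ → ℂ}
    (hf : ComplexAnalyticOn f (symInterval a))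
    (htop : a = ∞ → ∀ ω : ℝ, ω ≠ 0 → ‖ω‖ₑ < singularityDist f → ∃ L : ℂ, HasSgnHilbert f a ω L) :
    ∃ T : ℕ → ℂ, (∀ k, HasFinitePart (reflQuot f (k + 1)) a (T k)) ∧
      ∀ ω : ℝ, (ω ≠ 0 ∨ f 0 = 0) → ‖ω‖ₑ < min a (singularityDist f) →
        ∃ S, HasSum (fun k => (ω : ℂ) ^ k * T k) S ∧
          HasSgnHilbert f a ω (-S + 2 * f ω * (Real.log |ω| : ℂ)) := by
  obtain ⟨h₀, hh₀, hh₀'⟩ := ENNReal.lt_iff_exists_nnreal_btwn.1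
    (lt_min ha (singularityDist_pos ha hf))
  have hpos : 0 < h₀ := by exact_mod_cast hh₀
  have hpos' : (0 : ℝ) < h₀ := by exact_mod_cast hpos
  have hω' : ∀ ω : ℝ, (ω ≠ 0 ∨ f 0 = 0) → (ω ≠ 0 ∨ f ω = 0) := by
    intro ω h
    by_cases h0 : ω = 0
    · subst h0; exact h
    · exact Or.inl h0
  have hext : ∀ r : NNReal, 0 < r → (r : ℝ≥0∞) < min a (singularityDist f) → ExtendsToDisc f r :=
    fun r hr hra => extendsToDisc_of_lt_singularityDist hr hf (lt_min_iff.1 hra).1.le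
      (lt_min_iff.1 hra).2
  -- The coefficients are chosen with a fixed small radius `h₀`, before `ω` is given, since they
  -- must serve every `ω`.
  have hex : ∀ b : ℝ, ∃ U : ℕ → ℂ, h₀ ≤ b → ENNReal.ofReal b ≤ a →
      ∀ k, HasFinitePartTo (reflQuot f (k + 1)) b (U k) := by
    intro b
    by_cases hb : (h₀ : ℝ) ≤ b ∧ ENNReal.ofReal b ≤ a
    · obtain ⟨U, C, hU⟩ := exists_hasFinitePartTo_reflQuot hpos' hb.1
        (hf.continuousOn_Icc hb.2) (hext h₀ hpos hh₀')
      exact ⟨fun k => U (k + 1), fun _ _ k => (hU (k + 1)).1⟩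
    · exact ⟨0, fun h1 h2 => absurd ⟨h1, h2⟩ hb⟩
  choose T hT using hex
  by_cases hatop : a = ∞
  · subst hatop
    have hfc : Continuous f := by
      rw [← continuousOn_univ]
      convert hf.continuousOn using 1
      ext x; simp [symInterval]
    have hPV : ∀ r : NNReal, (r : ℝ≥0∞) < min ∞ (singularityDist f) → ∀ ω : ℝ, ω ≠ 0 → |ω| < r →
        ∃ L, HasSgnHilbert f ∞ ω L := by
      intro r hr ω hω hωr
      refine htop rfl ω hω (lt_trans ?_ (lt_min_iff.1 hr).2)
      rw [enorm_lt_coe]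
      exact_mod_cast hωr
    have main : ∀ r : NNReal, h₀ ≤ r → (r : ℝ≥0∞) < min ∞ (singularityDist f) →
        ∃ T' : ℕ → ℂ, (∀ k, Tendsto (fun b => T b k) atTop (𝓝 (T' k))) ∧
        ∀ ω : ℝ, |ω| < r → (ω ≠ 0 ∨ f ω = 0) → ∃ S, HasSum (fun k => (ω : ℂ) ^ k * T' k) S ∧
        HasSgnHilbert f ∞ ω (-S + 2 * f ω * (Real.log |ω| : ℂ)) := by
      intro r hr hrρ
      have hr' : (h₀ : ℝ) ≤ r := by exact_mod_cast hr
      exact hasSum_and_hasSgnHilbert_top (hpos'.trans_le hr') hfc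
        (hext r (hpos.trans_le hr) hrρ) (hPV r hrρ) fun b hb => hT b (hr'.trans hb) le_top
    obtain ⟨T', hT', -⟩ := main h₀ le_rfl hh₀'
    refine ⟨T', fun k => Or.inr ⟨rfl, fun b => T b k, ?_, hT' k⟩, fun ω hω hωρ => ?_⟩
    · filter_upwards [eventually_ge_atTop (h₀ : ℝ)] with b hb using hT b hb le_top k
    · obtain ⟨r, hr1, hr2⟩ := exists_nnreal_btwn hωρ
      -- A radius beyond `|ω|` is needed for the sum; the limiting coefficients it produces coincide
      -- with `T'` by uniqueness of limits.
      obtain ⟨T'', hT'', h2⟩ := main (max r h₀) (le_max_right _ _)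
        (by rw [ENNReal.coe_max]; exact max_lt hr2 hh₀')
      have : T'' = T' := funext fun k => tendsto_nhds_unique (hT'' k) (hT' k)
      subst this
      exact h2 ω (hr1.trans_le (by exact_mod_cast le_max_left r h₀)) (hω' ω hω)
  · have hle : ∀ r : NNReal, (r : ℝ≥0∞) < min a (singularityDist f) → (r : ℝ) ≤ a.toReal := by
      intro r hr
      exact (ENNReal.toReal_mono hatop (lt_min_iff.1 hr).1.le)
    have hTa := hT a.toReal (hle h₀ hh₀') ENNReal.ofReal_toReal_le
    refine ⟨T a.toReal, fun k => Or.inl ⟨hatop, hTa k⟩, fun ω hω hωρ => ?_⟩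
    obtain ⟨r, hr1, hr2⟩ := exists_nnreal_btwn hωρ
    have hr0 : 0 < r := by exact_mod_cast (abs_nonneg ω).trans_lt hr1
    obtain ⟨S, hS1, hS2⟩ := hasSum_and_hasPVTo hr1 (hle r hr2) (hω' ω hω)
      (hf.continuousOn_Icc ENNReal.ofReal_toReal_le) (hext r hr0 hr2) hTa
    exact ⟨S, hS1, Or.inl ⟨hatop, hS2⟩⟩

/-! ### Transfer of finite parts to `0 < a ≤ ∞` -/

theorem UpTo.imp {P Q : ℝ → ℂ → Prop} {a : ℝ≥0∞} (ha : 0 < a) {L : ℂ} (c : ℂ) (h : UpTo P a L)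
    (hPQ : ∀ b, 0 < b → ENNReal.ofReal b ≤ a → ∀ M, P b M → Q b (c * M)) : UpTo Q a (c * L) := by
  rcases h with ⟨h1, h2⟩ | ⟨rfl, v, h2, h3⟩
  · exact Or.inl ⟨h1, hPQ _ (ENNReal.toReal_pos ha.ne' h1) ENNReal.ofReal_toReal_le _ h2⟩
  · refine Or.inr ⟨rfl, fun b => c * v b, ?_, h3.const_mul c⟩
    filter_upwards [h2, eventually_gt_atTop 0] with b h4 h5 using hPQ b h5 le_top _ h4

theorem HasFinitePart.congr {φ ψ : ℝ → ℂ} {a : ℝ≥0∞} (ha : 0 < a) {L : ℂ}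
    (h : HasFinitePart φ a L) (e : ∀ x ∈ symInterval a, 0 < x → φ x = ψ x) :
    HasFinitePart ψ a L := by
  have := UpTo.imp (Q := HasFinitePartTo ψ) ha 1 h fun b hb hba M hM => by
    rw [one_mul]
    exact hM.congr hb fun x hx hxb => e x (mem_symInterval hba (by rwa [abs_of_pos hx])) hx
  rwa [one_mul] at this

theorem HasFinitePart.const_mul {φ : ℝ → ℂ} {a : ℝ≥0∞} (ha : 0 < a) {L : ℂ}
    (h : HasFinitePart φ a L) (c : ℂ) : HasFinitePart (fun x => c * φ x) a (c * L) :=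
  UpTo.imp ha c h fun _ _ _ _ hM => hM.const_mul c

theorem HasFinitePart.eq_zero {φ : ℝ → ℂ} {a : ℝ≥0∞} (ha : 0 < a) {L : ℂ}
    (h : HasFinitePart φ a L) (e : ∀ x ∈ symInterval a, 0 < x → φ x = 0) : L = 0 := by
  have h0 := h.congr ha (ψ := fun _ => 0) e
  rcases h0 with ⟨-, h2⟩ | ⟨-, v, h2, h3⟩
  · exact h2.unique HasFinitePartTo.zero
  · refine tendsto_nhds_unique h3 (tendsto_const_nhds.congr' ?_)
    filter_upwards [h2] with b hb using (hb.unique HasFinitePartTo.zero).symm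

theorem HasFinitePart.hasIntegral {φ ψ : ℝ → ℂ} {a : ℝ≥0∞} (ha : 0 < a) {L : ℂ}
    (h : HasFinitePart φ a L) (e : ∀ x ∈ symInterval a, 0 < x → φ x = ψ x)
    (hψ : ContinuousOn ψ (symInterval a)) : HasIntegral ψ a L := by
  have := UpTo.imp (Q := HasIntegralTo ψ) ha 1 (h.congr ha e) fun b hb hba M hM => by
    have hi : IntervalIntegrable ψ volume 0 b := by
      refine (hψ.mono fun x hx => mem_symInterval hba ?_).intervalIntegrable
      rw [Set.uIcc_of_le hb.le] at hx
      rw [abs_of_nonneg hx.1]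
      exact hx.2
    rw [one_mul]
    exact ⟨hi, (HasFinitePartTo.of_intervalIntegrable hb hi).unique hM⟩
  rwa [one_mul] at this

theorem neg_mem_symInterval {a : ℝ≥0∞} {x : ℝ} (hx : x ∈ symInterval a) :
    -x ∈ symInterval a := by
  simpa [symInterval] using hx

theorem continuousOn_comp_neg {g : ℝ → ℂ} {a : ℝ≥0∞} (hg : ContinuousOn g (symInterval a)) :
    ContinuousOn (fun x => g (-x)) (symInterval a) :=
  hg.comp (by fun_prop) fun _ hx => neg_mem_symInterval hx

/-! ### Even and odd functions -/

section Parity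

variable {a : ℝ≥0∞} {f : ℝ → ℂ} {δ : ℕ} {T : ℕ → ℂ}

theorem hasFinitePart_eq_zero_of_parity (ha : 0 < a)
    (hf : ∀ x ∈ symInterval a, f (-x) = (-1) ^ δ * f x)
    (hT : ∀ k, HasFinitePart (reflQuot f (k + 1)) a (T k)) {k : ℕ} (hk : Odd (k + δ)) :
    T k = 0 := by
  refine (hT k).eq_zero ha fun x hx _ => ?_
  rw [reflQuot, hf x hx, ← mul_assoc, ← pow_add]
  have : Odd (k + 1 + 1 + δ) := by
    rw [show k + 1 + 1 + δ = k + δ + 2 by ring]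
    exact hk.add_even even_two
  rw [this.neg_one_pow]
  simp

theorem hasFinitePart_of_parity (ha : 0 < a)
    (hf : ∀ x ∈ symInterval a, f (-x) = (-1) ^ δ * f x)
    (hT : ∀ k, HasFinitePart (reflQuot f (k + 1)) a (T k)) {k : ℕ} (hk : Even (k + δ)) :
    HasFinitePart (fun x => f x / (x : ℂ) ^ (k + 1)) a (1 / 2 * T k) := by
  refine ((hT k).const_mul ha _).congr ha fun x hx _ => ?_
  rw [reflQuot, hf x hx, ← mul_assoc ((-1) ^ (k + 1 + 1)), ← pow_add]
  have : Even (k + 1 + 1 + δ) := by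
    rw [show k + 1 + 1 + δ = k + δ + 2 by ring]
    exact hk.add even_two
  rw [this.neg_one_pow]
  ring

/-- Only indices of the parity of `δ` contribute, and `δ < 2` ensures that `2 * k + δ` runs through
all of them. -/
theorem hasSum_of_parity (ha : 0 < a) (hδ : δ < 2)
    (hf : ∀ x ∈ symInterval a, f (-x) = (-1) ^ δ * f x)
    (hT : ∀ k, HasFinitePart (reflQuot f (k + 1)) a (T k)) {z S : ℂ}
    (hS : HasSum (fun k => z ^ k * T k) S) :
    HasSum (fun k => z ^ (2 * k + δ) * (1 / 2 * T (2 * k + δ))) (1 / 2 * S) := by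
  have hinj : Function.Injective fun k : ℕ => 2 * k + δ := fun i j h => by
    simp only at h; omega
  have h1 := ((hinj.hasSum_iff (f := fun k => z ^ k * T k) fun k hk => ?_).2 hS).mul_left (1 / 2)
  · refine h1.congr_fun fun k => ?_
    simp only [Function.comp]
    ring
  · have hodd : Odd (k + δ) := by
      by_contra h
      rw [Nat.not_odd_iff_even, Nat.even_iff] at h
      exact hk ⟨(k - δ) / 2, by simp only; omega⟩
    simp only [hasFinitePart_eq_zero_of_parity ha hf hT hodd, mul_zero]

end Parity

/-! ### A zero of order `m` at the origin -/

section Zero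

variable {a : ℝ≥0∞} {f g : ℝ → ℂ} {m : ℕ} {T : ℕ → ℂ}

theorem reflQuot_zeroOrder (hfg : ∀ x ∈ symInterval a, f x = (x : ℂ) ^ m * g x) {x : ℝ}
    (hx : x ∈ symInterval a) (k : ℕ) :
    reflQuot f (k + 1) x =
      (x : ℂ) ^ m * ((-1) ^ (k + m) * g (-x) + g x) / (x : ℂ) ^ (k + 1) := by
  rw [reflQuot, hfg x hx, hfg _ (neg_mem_symInterval hx)]
  push_cast
  rw [neg_pow (x : ℂ) m]
  ring

theorem hasIntegral_zeroOrder (ha : 0 < a) (hg : ContinuousOn g (symInterval a))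
    (hfg : ∀ x ∈ symInterval a, f x = (x : ℂ) ^ m * g x)
    (hT : ∀ k, HasFinitePart (reflQuot f (k + 1)) a (T k)) {k : ℕ} (hk : k < m) :
    HasIntegral (fun x : ℝ => (x : ℂ) ^ (m - k - 1) * ((-1 : ℂ) ^ (k + m) * g (-x) + g x)) a
      (T k) := by
  refine (hT k).hasIntegral ha (fun x hx hx0 => ?_) ?_
  · have hx' : (x : ℂ) ≠ 0 := by exact_mod_cast hx0.ne'
    have : (x : ℂ) ^ m = (x : ℂ) ^ (m - k - 1) * (x : ℂ) ^ (k + 1) := by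
      rw [← pow_add]; congr 1; omega
    rw [reflQuot_zeroOrder hfg hx, this]
    field_simp
  · exact ContinuousOn.mul (by fun_prop)
      ((continuousOn_const.mul (continuousOn_comp_neg hg)).add hg)

theorem hasFinitePart_zeroOrder (ha : 0 < a)
    (hfg : ∀ x ∈ symInterval a, f x = (x : ℂ) ^ m * g x)
    (hT : ∀ k, HasFinitePart (reflQuot f (k + 1)) a (T k)) (k : ℕ) :
    HasFinitePart (fun x : ℝ => ((-1 : ℂ) ^ k * g (-x) + g x) / (x : ℂ) ^ (k + 1)) a
      (T (k + m)) := by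
  refine (hT (k + m)).congr ha fun x hx hx0 => ?_
  have hx' : (x : ℂ) ≠ 0 := by exact_mod_cast hx0.ne'
  rw [reflQuot_zeroOrder hfg hx, add_assoc k m m, pow_add _ k (m + m), (Even.add_self m).neg_one_pow,
    mul_one, show k + m + 1 = m + (k + 1) by ring, pow_add _ m (k + 1)]
  field_simp

theorem parity_zeroOrder (hfg : ∀ x ∈ symInterval a, f x = (x : ℂ) ^ m * g x)
    (hg : ∀ x ∈ symInterval a, g (-x) = g x) :
    ∀ x ∈ symInterval a, f (-x) = (-1) ^ (m % 2) * f x := by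
  intro x hx
  rw [hfg x hx, hfg _ (neg_mem_symInterval hx), hg x hx, ← neg_one_pow_eq_pow_mod_two]
  push_cast
  rw [neg_pow (x : ℂ) m]
  ring

end Zero

end HilbertFP

/-! ### The four cases -/

open HilbertFP in
theorem theorem4p2 (a : ℝ≥0∞) (ha : 0 < a) (f : ℝ → ℂ)
    (hf : ComplexAnalyticOn f (symInterval a))
    (htop : a = ∞ → ∀ ω : ℝ, ω ≠ 0 → ‖ω‖ₑ < singularityDist f → ∃ L : ℂ, HasSgnHilbert f a ω L) :
    -- the case `f 0 ≠ 0`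
    (f 0 ≠ 0 →
      (∃ T : ℕ → ℂ,
        (∀ k : ℕ, HasFinitePart
          (fun x : ℝ => ((-1 : ℂ) ^ k * f (-x) + f x) / (x : ℂ) ^ (k + 1)) a (T k)) ∧
        ∀ ω : ℝ, ω ≠ 0 → ‖ω‖ₑ < min a (singularityDist f) →
          ∃ S : ℂ, HasSum (fun k : ℕ => (ω : ℂ) ^ k * T k) S ∧
            HasSgnHilbert f a ω (-S + 2 * f ω * (Real.log |ω| : ℂ))) ∧
      -- `f` even
      ((∀ x ∈ symInterval a, f (-x) = f x) →
        ∃ T : ℕ → ℂ,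
          (∀ k : ℕ, HasFinitePart (fun x : ℝ => f x / (x : ℂ) ^ (2 * k + 1)) a (T k)) ∧
          ∀ ω : ℝ, ω ≠ 0 → ‖ω‖ₑ < min a (singularityDist f) →
            ∃ S : ℂ, HasSum (fun k : ℕ => (ω : ℂ) ^ (2 * k) * T k) S ∧
              HasSgnHilbert f a ω (-2 * S + 2 * f ω * (Real.log |ω| : ℂ)))) ∧
    -- the case of a zero of order `m ≥ 1` at the origin
    (∀ (m : ℕ) (g : ℝ → ℂ), 1 ≤ m → ComplexAnalyticOn g (symInterval a) → g 0 ≠ 0 →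
      (∀ x ∈ symInterval a, f x = (x : ℂ) ^ m * g x) →
      (∃ J T : ℕ → ℂ,
        (∀ k < m, HasIntegral
          (fun x : ℝ => (x : ℂ) ^ (m - k - 1) * ((-1 : ℂ) ^ (k + m) * g (-x) + g x)) a (J k)) ∧
        (∀ k : ℕ, HasFinitePart
          (fun x : ℝ => ((-1 : ℂ) ^ k * g (-x) + g x) / (x : ℂ) ^ (k + 1)) a (T k)) ∧
        ∀ ω : ℝ, ‖ω‖ₑ < min a (singularityDist f) →
          ∃ S : ℂ, HasSum (fun k : ℕ => (ω : ℂ) ^ (k + m) * T k) S ∧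
            HasSgnHilbert f a ω (-(∑ k ∈ Finset.range m, (ω : ℂ) ^ k * J k) - S
              + 2 * (ω : ℂ) ^ m * g ω * (Real.log |ω| : ℂ))) ∧
      -- `g` even; the finite sum over `0 ≤ k ≤ ⌊(m - 2) / 2⌋` is over `k < ⌊m / 2⌋`
      ((∀ x ∈ symInterval a, g (-x) = g x) →
        ∃ J T : ℕ → ℂ,
          (∀ k < m / 2, HasIntegral
            (fun x : ℝ => (x : ℂ) ^ (2 * (m / 2) - 2 * k - 1) * g x) a (J k)) ∧
          (∀ k : ℕ, HasFinitePart (fun x : ℝ => g x / (x : ℂ) ^ (2 * k + 1)) a (T k)) ∧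
          ∀ ω : ℝ, ‖ω‖ₑ < min a (singularityDist f) →
            ∃ S : ℂ, HasSum (fun k : ℕ => (ω : ℂ) ^ (2 * k + m) * T k) S ∧
              HasSgnHilbert f a ω (-2 * S + 2 * (ω : ℂ) ^ m * g ω * (Real.log |ω| : ℂ)
                - 2 * ∑ k ∈ Finset.range (m / 2),
                    (ω : ℂ) ^ (2 * k + 2 * ((m + 1) / 2) - m) * J k))) := by
  obtain ⟨T, hT, hmain⟩ := exists_hasFinitePart_hasSgnHilbert ha hf htop
  refine ⟨fun _ => ⟨⟨T, fun k => ?_, fun ω hω hωρ => hmain ω (Or.inl hω) hωρ⟩, fun heven => ?_⟩,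
    fun m g hm hg _ hfg => ⟨?_, fun heven => ?_⟩⟩
  · refine (hT k).congr ha fun x _ _ => ?_
    rw [reflQuot, pow_succ (-1 : ℂ) (k + 1), pow_succ (-1 : ℂ) k]
    ring
  · have hf0 : ∀ x ∈ symInterval a, f (-x) = (-1) ^ 0 * f x := fun x hx => by
      rw [heven x hx, pow_zero, one_mul]
    refine ⟨fun k => 1 / 2 * T (2 * k), fun k => hasFinitePart_of_parity ha hf0 hT (by simp),
      fun ω hω hωρ => ?_⟩
    obtain ⟨S, hS, hPV⟩ := hmain ω (Or.inl hω) hωρ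
    refine ⟨1 / 2 * S, hasSum_of_parity ha two_pos hf0 hT hS, ?_⟩
    convert hPV using 1
    ring
  all_goals
    have h0mem : (0 : ℝ) ∈ symInterval a := by simp [symInterval]
    have hf0 : f 0 = 0 := by
      rw [hfg 0 h0mem, Complex.ofReal_zero, zero_pow (by omega), zero_mul]
    have hfω : ∀ ω : ℝ, ‖ω‖ₑ < min a (singularityDist f) → f ω = (ω : ℂ) ^ m * g ω :=
      fun ω hω => hfg ω (lt_min_iff.1 hω).1.le
  · refine ⟨T, fun k => T (k + m), fun k hk => hasIntegral_zeroOrder ha hg.continuousOn hfg hT hk,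
      hasFinitePart_zeroOrder ha hfg hT, fun ω hωρ => ?_⟩
    obtain ⟨S, hS, hPV⟩ := hmain ω (Or.inr hf0) hωρ
    refine ⟨_, (hasSum_nat_add_iff' m).2 hS, ?_⟩
    convert hPV using 1
    rw [hfω ω hωρ]
    ring
  · have hpar := parity_zeroOrder hfg heven
    have hδ : m % 2 < 2 := Nat.mod_lt _ two_pos
    have hm2 := Nat.div_add_mod m 2
    -- Since `f` has the parity of `m`, the surviving indices are `2 * k + m % 2`. Those with `k < m
    -- / 2` lie below `m` and give the ordinary integrals; the others are the `2 * k + m`.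
    refine ⟨fun k => 1 / 2 * T (2 * k + m % 2), fun k => 1 / 2 * T (2 * k + m), fun k hk => ?_,
      fun k => ?_, fun ω hωρ => ?_⟩
    · refine (hasFinitePart_of_parity ha hpar hT (k := 2 * k + m % 2) ?_).hasIntegral ha
        (fun x hx hx0 => ?_) (ContinuousOn.mul (by fun_prop) hg.continuousOn)
      · rw [add_assoc]; exact (even_two_mul k).add (Even.add_self _)
      · have hx' : (x : ℂ) ≠ 0 := by exact_mod_cast hx0.ne'
        have : (x : ℂ) ^ m = (x : ℂ) ^ (2 * (m / 2) - 2 * k - 1) * (x : ℂ) ^ (2 * k + m % 2 + 1) := by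
          rw [← pow_add]; congr 1; omega
        rw [hfg x hx, this]
        field_simp
    · refine (hasFinitePart_of_parity ha hpar hT (k := 2 * k + m) ?_).congr ha fun x hx hx0 => ?_
      · rw [Nat.even_iff]; omega
      · have hx' : (x : ℂ) ≠ 0 := by exact_mod_cast hx0.ne'
        rw [hfg x hx, show 2 * k + m + 1 = m + (2 * k + 1) by ring, pow_add _ m (2 * k + 1)]
        field_simp
    · obtain ⟨S, hS, hPV⟩ := hmain ω (Or.inr hf0) hωρ
      have h1 := (hasSum_nat_add_iff' (m / 2)).2 (hasSum_of_parity ha hδ hpar hT hS)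
      have e1 : ∀ k : ℕ, 2 * (k + m / 2) + m % 2 = 2 * k + m := fun k => by omega
      have e2 : ∀ k : ℕ, 2 * k + 2 * ((m + 1) / 2) - m = 2 * k + m % 2 := fun k => by omega
      simp only [e1] at h1
      refine ⟨_, h1, ?_⟩
      simp only [e2]
      convert hPV using 1
      rw [hfω ω hωρ]
      ring
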